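/- **Conventions.** Let $M$ be a smooth closed $4$-manifold. Write $H^n_g$ for the $n$-dimensional handlebody of genus $g$ (an $n$-ball with $g$ orientable $1$-handles attached). A *$(g,k)$-trisection* of $M$ is a decomposition $M=X_1\cup X_2\cup X_3$ such that each $X_i$ is a smooth codimension-$0$ submanifold whose only corner is along $X_1\cap X_2\cap X_3$ and which, after straightening this corner, is diffeomorphic to $H^4_k$; for $i\ne j$ the intersection $X_i\cap X_j$ is a smoothly embedded copy of $H^3_g$ with boundary $X_1\cap X_2\cap X_3$; and for $\{i,j,l\}=\{1,2,3\}$, $\partial X_i=(X_i\cap X_j)\cup(X_i\cap X_l)$ (so this is a genus $g$ Heegaard splitting of $\partial X_i\cong\#^kS^1\times S^2$). Two trisections $X_1\cup X_2\cup X_3$ and $X_1'\cup X_2'\cup X_3'$ of $M$ are *diffeomorphic via* a diffeomorphism $f:M\to M$ if $f(X_i)=X_i'$ for $i=1,2,3$, and *isotopic* if there is a smooth isotopy $f_t$ of $M$ through diffeomorphisms, $t\in[0,1]$, with $f_0=\mathrm{id}$ and $f_1(X_i)=X_i'$ for $i=1,2,3$. Two $n$-tuples $(a_1,\dots,a_n)$,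 $(b_1,\dots,b_n)$ of generators of a group $G$ are *Nielsen equivalent* if there are a basis $(y_1,\dots,y_n)$ of the free group $F(x_1,\dots,x_n)$ and a homomorphism $\phi:F(x_1,\dots,x_n)\to G$ with $\phi(x_i)=a_i$ and $\phi(y_i)=b_i$ for all $i$; an equivalence class is called a *Nielsen class*. A *spine* of $X_i$ is an embedded wedge of $k$ oriented circles in $X_i$ which is a deformation retract of $X_i$. For $x_0\in M$ let $\mathscr N_{x_0}(X_i)$ be the set of all $k$-tuples in $\pi_1(M,x_0)$ that are Nielsen equivalent to a tuple formed by the loops of a spine of $X_i$, carried to the base point $x_0$ along some path from $x_0$ to the vertex of the spine. **Proposition.** Let $X_1\cup X_2\cup X_3$ and $X_1'\cup X_2'\cup X_3'$ be two $(g,k)$-trisections of $M$, and let $x_0 \in M$ be any point. 1. For each $i$, $\mathscr N_{x_0}(X_i)$ and $\mathscr N_{x_0}(X_i')$ are Nielsen classes of generating $k$-tuples of $\pi_1(M,x_0)$ (that is, each is exactly one class, independent of the spine and the path). 2. If the trisections are isotopic, then $\mathscr N_{x_0}(X_i)=\mathscr N_{x_0}(X_i')$ for $i=1,2,3$. 3.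 If the trisections are diffeomorphic via $f$, then $f_*(\mathscr N_{x_0}(X_i))=\mathscr N_{f(x_0)}(X_i')$ for $i=1,2,3$, where $f_*:\pi_1(M,x_0)\to\pi_1(M,f(x_0))$ is the induced map. 4. Consequently, if the trisections are diffeomorphic, then there is a single automorphism $\theta$ of $\pi_1(M,x_0)$ with $\theta(\mathscr N_{x_0}(X_i))=\mathscr N_{x_0}(X_i')$ for $i=1,2,3$. -/

import Mathlib

open Set Manifold
open scoped ContDiff unitInterval

noncomputable section

namespace Trisection

/-! ### Nielsen equivalence -/

/-- Two `n`-tuples `a`, `b` in a group `G` are Nielsen equivalent if there are a basis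
`y₁, …, yₙ` of the free group `F(x₁, …, xₙ)` and a homomorphism `φ : F(x₁, …, xₙ) → G`
with `φ xᵢ = aᵢ` and `φ yᵢ = bᵢ`. -/
def NielsenEquiv {G : Type*} [Group G] {n : ℕ} (a b : Fin n → G) : Prop :=
  ∃ (y : FreeGroupBasis (Fin n) (FreeGroup (Fin n))) (φ : FreeGroup (Fin n) →* G),
    (∀ i, φ (FreeGroup.of i) = a i) ∧ ∀ i, φ (y i) = b i

/-- A set of `n`-tuples is a Nielsen class of generators of `G` if it consists of all the tuples
that are Nielsen equivalent to one fixed generating `n`-tuple. -/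
def IsNielsenClass {G : Type*} [Group G] {n : ℕ} (S : Set (Fin n → G)) : Prop :=
  ∃ a : Fin n → G, Subgroup.closure (range a) = ⊤ ∧ S = {b | NielsenEquiv a b}

/-! ### Standard handlebodies -/

/-- A smooth function on the plane which is nonnegative exactly on a disc with `g` holes `P_g`,
namely on the disc `‖z‖ ≤ 5` with the `g` components of `‖z ^ g - 2‖ < 1 / 2` removed (for `g = 0`
there are none), positive exactly in the interior of `P_g`, and with `0` as a regular value. -/
def planarFun (g : ℕ) (z : ℂ) : ℝ := (25 - ‖z‖ ^ 2) * (‖z ^ g - 2‖ ^ 2 - 1 / 4)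

/-- The standard handlebody of genus `g` in `ℂ × V` (of dimension `dim V + 2`): the disc with `g`
holes, thickened in the directions of `V` to a compact domain with smooth boundary. It is
diffeomorphic to a ball with `g` orientable 1-handles attached. For `V = ℝ` this is the
3-dimensional handlebody, for `V = ℂ` the 4-dimensional 1-handlebody of genus `g`. -/
def handlebody (V : Type*) [NormedAddCommGroup V] (g : ℕ) : Set (ℂ × V) :=
  {p | ‖p.2‖ ^ 2 ≤ planarFun g p.1}

/-- The boundary of the standard handlebody. -/
def handlebodyBoundary (V : Type*) [NormedAddCommGroup V] (g : ℕ) : Set (ℂ × V) :=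
  {p | ‖p.2‖ ^ 2 = planarFun g p.1}

/-! ### Spines and the Nielsen class of a handlebody -/

section Spines

variable {M : Type*} [TopologicalSpace M]

/-- The graph with the vertex `v` and the edges `ℓ i`. -/
def roseSet {k : ℕ} {v : M} (ℓ : Fin k → Path v v) : Set M := {v} ∪ ⋃ i, range (ℓ i)

/-- The loops `ℓ i` at `v` are the oriented edges of a one-vertex spine of `H ⊆ M`: they form an
embedded wedge of `k` circles in `H`, which is a (strong) deformation retract of `H`. -/
structure IsSpine (H : Set M) {k : ℕ} {v : M} (ℓ : Fin k → Path v v) : Prop where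
  subset : roseSet ℓ ⊆ H
  embedded : ∀ i j s t, ℓ i s = ℓ j t →
    (i = j ∧ s = t) ∨ ((s = 0 ∨ s = 1) ∧ (t = 0 ∨ t = 1))
  retract : ∃ D : C(I × H, H), (∀ x : H, D (0, x) = x) ∧
    (∀ x : H, (D (1, x) : M) ∈ roseSet ℓ) ∧
    ∀ (t : I) (x : H), (x : M) ∈ roseSet ℓ → D (t, x) = x

/-- The tuple of elements of `π₁(M, x₀)` obtained from loops at `v` by means of a path from `x₀`
to `v`. -/
def loopClasses {k : ℕ} {x₀ v : M} (γ : Path x₀ v) (ℓ : Fin k → Path v v) :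
    Fin k → FundamentalGroup M x₀ :=
  fun i => FundamentalGroup.fromPath
    (Path.Homotopic.Quotient.mk ((γ.trans (ℓ i)).trans γ.symm))

/-- The Nielsen class of `k`-tuples in `π₁(M, x₀)` obtained from the spines of a genus `k`
handlebody `H ⊆ M`, where a spine with vertex `v` is joined to the base point by any path from `x₀`
to `v`. -/
def nielsenClass (k : ℕ) (H : Set M) (x₀ : M) : Set (Fin k → FundamentalGroup M x₀) :=
  {b | ∃ (v : M) (ℓ : Fin k → Path v v) (γ : Path x₀ v),
    IsSpine H ℓ ∧ NielsenEquiv (loopClasses γ ℓ) b}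

/-- The image in `π₁(M, f x₀)` of a set of tuples in `π₁(M, x₀)` under the map induced by `f`. -/
def inducedImage {k : ℕ} (f : C(M, M)) (x₀ : M) (S : Set (Fin k → FundamentalGroup M x₀)) :
    Set (Fin k → FundamentalGroup M (f x₀)) :=
  (fun a i => FundamentalGroup.map f x₀ (a i)) '' S

end Spines

/-! ### Trisections -/

section Trisections

/-- An open partial homeomorphism is a diffeomorphism from its source onto its target. -/
def IsPartialDiffeo {E E' H H' N N' : Type*} [NormedAddCommGroup E] [NormedSpace ℝ E]
    [NormedAddCommGroup E'] [NormedSpace ℝ E'] [TopologicalSpace H] [TopologicalSpace H']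
    [TopologicalSpace N] [TopologicalSpace N'] [ChartedSpace H N] [ChartedSpace H' N']
    (J : ModelWithCorners ℝ E H) (J' : ModelWithCorners ℝ E' H')
    (e : OpenPartialHomeomorph N N') : Prop :=
  ContMDiffOn J J' ∞ e e.source ∧ ContMDiffOn J' J ∞ e.symm e.target

variable {M : Type*} [TopologicalSpace M] [ChartedSpace (EuclideanSpace ℝ (Fin 4)) M]

/-- `Y ⊆ M` is a smoothly embedded 3-dimensional handlebody of genus `g` with boundary `S`. -/
def IsEmbeddedHandlebody₃ (g : ℕ) (Y S : Set M) : Prop :=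
  ∃ φ : ℂ × ℝ → M,
    ContMDiffOn 𝓘(ℝ, ℂ × ℝ) (𝓡 4) ∞ φ (handlebody ℝ g) ∧
    (∀ p ∈ handlebody ℝ g, Function.Injective
      (mfderivWithin 𝓘(ℝ, ℂ × ℝ) (𝓡 4) φ (handlebody ℝ g) p)) ∧
    InjOn φ (handlebody ℝ g) ∧
    φ '' handlebody ℝ g = Y ∧
    φ '' handlebodyBoundary ℝ g = S

/-- Near `p ∈ K`, the map `φ : K → M` is the restriction of a diffeomorphism between open sets. -/
def IsDiffeoAt (φ : ℂ × ℂ → M) (K : Set (ℂ × ℂ)) (p : ℂ × ℂ) : Prop :=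
  ∃ e : OpenPartialHomeomorph (ℂ × ℂ) M, IsPartialDiffeo 𝓘(ℝ, ℂ × ℂ) (𝓡 4) e ∧
    p ∈ e.source ∧ EqOn φ e (K ∩ e.source)

/-- Near `p ∈ K`, the inverse of `φ : K → φ '' K` is the standard straightening of a corner: there
are smooth coordinates `a` of `M` at `φ p` in which `φ '' K` is `(quadrant) × ℂ` with corner locus
`C = {0} × ℂ`, and smooth coordinates `b` of `ℂ × ℂ` at `p` in which `K` is
`(upper half-plane) × ℂ`, such that in these coordinates the inverse of `φ` is `(z, w) ↦ (z², w)`,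
which doubles the angles at the corner. -/
def IsCornerStraightenedAt (φ : ℂ × ℂ → M) (K : Set (ℂ × ℂ)) (C : Set M) (p : ℂ × ℂ) : Prop :=
  ∃ (a : OpenPartialHomeomorph M (ℂ × ℂ)) (b : OpenPartialHomeomorph (ℂ × ℂ) (ℂ × ℂ)),
    IsPartialDiffeo (𝓡 4) 𝓘(ℝ, ℂ × ℂ) a ∧ IsPartialDiffeo 𝓘(ℝ, ℂ × ℂ) 𝓘(ℝ, ℂ × ℂ) b ∧
    φ p ∈ a.source ∧ p ∈ b.source ∧
    (∀ x ∈ a.source, x ∈ φ '' K ↔ 0 ≤ (a x).1.re ∧ 0 ≤ (a x).1.im) ∧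
    (∀ x ∈ a.source, x ∈ C ↔ (a x).1 = 0) ∧
    (∀ q ∈ b.source, q ∈ K ↔ 0 ≤ (b q).1.im) ∧
    ∀ q ∈ K ∩ b.source, φ q ∈ a.source ∧ b q = ((a (φ q)).1 ^ 2, (a (φ q)).2)

/-- `X ⊆ M` is a compact smooth codimension-zero submanifold with boundary `B`, with a corner
along `C` and no other corners, which after straightening the corner is diffeomorphic to the
4-dimensional 1-handlebody of genus `k`. -/
def IsCorneredHandlebody₄ (k : ℕ) (X B C : Set M) : Prop :=
  ∃ φ : ℂ × ℂ → M,
    ContinuousOn φ (handlebody ℂ k) ∧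
    InjOn φ (handlebody ℂ k) ∧
    φ '' handlebody ℂ k = X ∧
    φ '' handlebodyBoundary ℂ k = B ∧
    (∀ p ∈ handlebody ℂ k, φ p ∉ C → IsDiffeoAt φ (handlebody ℂ k) p) ∧
    ∀ p ∈ handlebody ℂ k, φ p ∈ C → IsCornerStraightenedAt φ (handlebody ℂ k) C p

/-- A `(g, k)`-trisection `M = X₀ ∪ X₁ ∪ X₂`, with central surface `X₀ ∩ X₁ ∩ X₂`. (Indices are
modulo 3.) The sectors are smooth 1-handlebodies of genus `k` with a corner along the central
surface, the pairwise intersections are smooth 3-dimensional handlebodies of genus `g`, and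
`∂Xᵢ = (Xᵢ ∩ Xᵢ₊₁) ∪ (Xᵢ ∩ Xᵢ₊₂)` is a genus `g` Heegaard splitting: its two handlebodies meet
exactly in the central surface, which is the boundary of each of them. -/
structure IsTrisection (g k : ℕ) (X : Fin 3 → Set M) : Prop where
  cover : ⋃ i, X i = univ
  sector : ∀ i, IsCorneredHandlebody₄ k (X i) ((X i ∩ X (i + 1)) ∪ (X i ∩ X (i + 2))) (⋂ j, X j)
  inter : ∀ i j, i ≠ j → IsEmbeddedHandlebody₃ g (X i ∩ X j) (⋂ l, X l)

/-- The trisections `X` and `X'` are isotopic: there is a smooth isotopy `F` of `M` from the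
identity to a diffeomorphism that carries each `X i` onto `X' i`. -/
def AreIsotopic (X X' : Fin 3 → Set M) : Prop :=
  ∃ F : I → (M ≃ₘ⟮𝓡 4, 𝓡 4⟯ M),
    ContMDiff ((𝓡∂ 1).prod (𝓡 4)) (𝓡 4) ∞ (fun p : I × M => F p.1 p.2) ∧
    (∀ x, F 0 x = x) ∧ ∀ i, F 1 '' X i = X' i

end Trisections

end Trisection

end

namespace Trisection
open Topology

/-! ### Homotopy classes of paths -/

section PathClasses

variable {B : Type*} [TopologicalSpace B] {a b c d : B}

theorem quotient_symm_trans_cancel (p : Path.Homotopic.Quotient a b)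
    (q : Path.Homotopic.Quotient b c) : p.symm.trans (p.trans q) = q := by
  rw [← Path.Homotopic.Quotient.trans_assoc, Path.Homotopic.Quotient.symm_trans,
      Path.Homotopic.Quotient.refl_trans]

theorem quotient_trans_symm_cancel (p : Path.Homotopic.Quotient a b)
    (q : Path.Homotopic.Quotient a c) : p.trans (p.symm.trans q) = q := by
  rw [← Path.Homotopic.Quotient.trans_assoc, Path.Homotopic.Quotient.trans_symm,
      Path.Homotopic.Quotient.refl_trans]

theorem quotient_symm_symm (p : Path.Homotopic.Quotient a b) : p.symm.symm = p := by
  obtain ⟨p, rfl⟩ := Path.Homotopic.Quotient.mk_surjective p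
  rw [← Path.Homotopic.Quotient.mk_symm, ← Path.Homotopic.Quotient.mk_symm, Path.symm_symm]

theorem quotient_trans_symm_rev (p : Path.Homotopic.Quotient a b)
    (q : Path.Homotopic.Quotient b c) : (p.trans q).symm = q.symm.trans p.symm := by
  obtain ⟨p, rfl⟩ := Path.Homotopic.Quotient.mk_surjective p
  obtain ⟨q, rfl⟩ := Path.Homotopic.Quotient.mk_surjective q
  rw [← Path.Homotopic.Quotient.mk_symm, ← Path.Homotopic.Quotient.mk_symm,
      ← Path.Homotopic.Quotient.mk_trans, ← Path.Homotopic.Quotient.mk_symm,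
        Path.trans_symm, Path.Homotopic.Quotient.mk_trans]

theorem quotient_refl_symm (x : B) : (Path.Homotopic.Quotient.refl x).symm = Path.Homotopic.Quotient.refl x := by
  rw [← Path.Homotopic.Quotient.mk_refl, ← Path.Homotopic.Quotient.mk_symm, Path.refl_symm]

theorem quotient_map_trans {B' : Type*} [TopologicalSpace B'] (f : C(B, B'))
    (p : Path.Homotopic.Quotient a b) (q : Path.Homotopic.Quotient b c) :
    (p.trans q).map f = (p.map f).trans (q.map f) := by
  obtain ⟨p, rfl⟩ := Path.Homotopic.Quotient.mk_surjective p
  obtain ⟨q, rfl⟩ := Path.Homotopic.Quotient.mk_surjective q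
  rw [← Path.Homotopic.Quotient.mk_trans, ← Path.Homotopic.Quotient.mk_map, Path.map_trans,
      Path.Homotopic.Quotient.mk_trans,
        Path.Homotopic.Quotient.mk_map, Path.Homotopic.Quotient.mk_map]

theorem quotient_map_symm {B' : Type*} [TopologicalSpace B'] (f : C(B, B'))
    (p : Path.Homotopic.Quotient a b) : p.symm.map f = (p.map f).symm := by
  obtain ⟨p, rfl⟩ := Path.Homotopic.Quotient.mk_surjective p
  rw [← Path.Homotopic.Quotient.mk_symm, ← Path.Homotopic.Quotient.mk_map, ← Path.map_symm,
      Path.Homotopic.Quotient.mk_symm, Path.Homotopic.Quotient.mk_map]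

/-- The product of path classes, as an element of the fundamental group. -/
theorem trans_mem {x : B} {S : Subgroup (FundamentalGroup B x)}
    {p q : Path.Homotopic.Quotient x x} (hp : p ∈ S) (hq : q ∈ S) : p.trans q ∈ S :=
  S.mul_mem hq hp

theorem symm_mem {x : B} {S : Subgroup (FundamentalGroup B x)}
    {p : Path.Homotopic.Quotient x x} (hp : p ∈ S) : p.symm ∈ S :=
  S.inv_mem hp

theorem refl_mem {x : B} (S : Subgroup (FundamentalGroup B x)) :
    Path.Homotopic.Quotient.refl x ∈ S :=
  S.one_mem

end PathClasses

instance : ContractibleSpace I := (convex_Icc (0 : ℝ) 1).contractibleSpace ⟨0, by simp⟩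

instance : LocallyPathConnectedSpace I := (convex_Icc (0 : ℝ) 1).locallyPathConnectedSpace

/-- Every point has a neighbourhood in which any two paths with the same end points are
homotopic in the whole space. -/
def SemilocallySimplyConnected (B : Type*) [TopologicalSpace B] : Prop :=
  ∀ y : B, ∃ U ∈ 𝓝 y, ∀ (a b : B) (p q : Path a b), range p ⊆ U → range q ⊆ U → p.Homotopic q

theorem SemilocallySimplyConnected.of_homeomorph {B B' : Type*} [TopologicalSpace B]
    [TopologicalSpace B'] (h : SemilocallySimplyConnected B) (e : B ≃ₜ B') :
    SemilocallySimplyConnected B' := by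
  intro y
  obtain ⟨U, hU, hUp⟩ := h (e.symm y)
  refine ⟨e.symm ⁻¹' U, e.symm.continuous.continuousAt hU, fun a b p q hp hq => ?_⟩
  have := (hUp _ _ (p.map e.symm.continuous) (q.map e.symm.continuous)
    (by rintro _ ⟨t, rfl⟩; exact hp ⟨t, rfl⟩) (by rintro _ ⟨t, rfl⟩; exact hq ⟨t, rfl⟩)).map
      ⟨e, e.continuous⟩
  have := this.pathCast (e.apply_symm_apply a).symm (e.apply_symm_apply b).symm
  convert this <;> ext t <;> simp

/-- A neighbourhood that embeds, up to a retraction, in a convex set makes paths homotopic. -/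
theorem homotopic_of_convex {B E : Type*} [TopologicalSpace B] [NormedAddCommGroup E]
    [NormedSpace ℝ E] {U : Set B} {C : Set E} {e : B → E} {r : E → B} (hC : Convex ℝ C)
    (he : ContinuousOn e U) (hr : ContinuousOn r C) (heC : MapsTo e U C)
    (hre : ∀ x ∈ U, r (e x) = x) {a b : B} (p q : Path a b) (hp : range p ⊆ U)
    (hq : range q ⊆ U) : p.Homotopic q := by
  have hp' : Continuous fun s => e (p s) :=
    he.comp_continuous p.continuous fun s => hp ⟨s, rfl⟩
  have hq' : Continuous fun s => e (q s) :=
    he.comp_continuous q.continuous fun s => hq ⟨s, rfl⟩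
  have ha : a ∈ U := hp ⟨0, p.source⟩
  have hb : b ∈ U := hp ⟨1, p.target⟩
  have hcomb : ∀ (t : ℝ) (x : B), (1 - t) • e x + t • e x = e x := fun t x => by
    rw [← add_smul]; simp
  refine ⟨⟨⟨⟨fun x : I × I => r ((1 - (x.1 : ℝ)) • e (p x.2) + (x.1 : ℝ) • e (q x.2)), ?_⟩,
    ?_, ?_⟩, ?_⟩⟩
  · have hs : Continuous fun x : I × I => (x.1 : ℝ) := continuous_subtype_val.comp continuous_fst
    refine hr.comp_continuous (((continuous_const.sub hs).smul (hp'.comp continuous_snd)).add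
      (hs.smul (hq'.comp continuous_snd))) fun x => ?_
    exact hC (heC (hp ⟨_, rfl⟩)) (heC (hq ⟨_, rfl⟩)) (by linarith [x.1.2.2]) x.1.2.1 (by ring)
  · intro s; simpa using hre _ (hp ⟨s, rfl⟩)
  · intro s; simpa using hre _ (hq ⟨s, rfl⟩)
  · rintro t s (rfl | rfl)
    · simp [hcomb, hre a ha]
    · simp [hcomb, hre b hb]

theorem semilocallySimplyConnected_of_chartedSpace (E M : Type*) [NormedAddCommGroup E]
    [NormedSpace ℝ E] [TopologicalSpace M] [ChartedSpace E M] : SemilocallySimplyConnected M := by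
  intro y
  obtain ⟨ε, hε, hball⟩ := Metric.isOpen_iff.1 (chartAt E y).open_target _ (mem_chart_target E y)
  refine ⟨(chartAt E y).source ∩ chartAt E y ⁻¹' Metric.ball (chartAt E y y) ε,
    Filter.inter_mem (chart_source_mem_nhds E y)
      ((chartAt E y).continuousAt (mem_chart_source E y) (Metric.ball_mem_nhds _ hε)), ?_⟩
  intro a b p q hp hq
  exact homotopic_of_convex (convex_ball _ _) ((chartAt E y).continuousOn.mono inter_subset_left)
    ((chartAt E y).symm.continuousOn.mono hball) (fun x hx => hx.2)
    (fun x hx => (chartAt E y).left_inv hx.1) p q hp hq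

section Retract

variable {E : Type*} [NormedAddCommGroup E] [NormedSpace ℝ E] {O K : Set E} {r : E → E}

theorem semilocallySimplyConnected_of_retract (hO : IsOpen O) (hKO : K ⊆ O)
    (hr : ContinuousOn r O) (hrK : MapsTo r O K) (hfix : ∀ x ∈ K, r x = x) :
    SemilocallySimplyConnected K := by
  intro y
  obtain ⟨ε, hε, hball⟩ := Metric.isOpen_iff.1 hO y (hKO y.2)
  refine ⟨Subtype.val ⁻¹' Metric.ball (y : E) ε,
    continuous_subtype_val.continuousAt (Metric.ball_mem_nhds _ hε), ?_⟩
  intro a b p q hp hq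
  classical
  have hrK' : ∀ x ∈ Metric.ball (y : E) ε, r x ∈ K := fun x hx => hrK (hball hx)
  refine homotopic_of_convex (U := Subtype.val ⁻¹' Metric.ball (y : E) ε) (e := Subtype.val)
    (r := fun x => if h : r x ∈ K then ⟨r x, h⟩ else y)
    (convex_ball (y : E) ε) continuous_subtype_val.continuousOn ?_ (fun x hx => hx) ?_ p q hp hq
  · rw [continuousOn_iff_continuous_domRestrict]
    have : (Metric.ball (y : E) ε).domRestrict (fun x => if h : r x ∈ K then (⟨r x,
        h⟩ : K) else y) =
        fun x => ⟨r x, hrK' x x.2⟩ := by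
      ext x; simp [Set.domRestrict, hrK' x x.2]
    rw [this]
    exact (hr.mono hball).domRestrict.subtype_mk _
  · intro x _
    have : r x = x := hfix x x.2
    simp [this]

theorem locallyPathConnectedSpace_of_retract (hO : IsOpen O) (hKO : K ⊆ O)
    (hr : ContinuousOn r O) (hrK : MapsTo r O K) (hfix : ∀ x ∈ K, r x = x) :
    LocallyPathConnectedSpace K := by
  have := hO.locallyPathConnectedSpace
  refine IsQuotientMap.locallyPathConnectedSpace (X := O) (f := hrK.restrict r O K) ?_
  exact IsQuotientMap.of_inverse (continuous_inclusion hKO)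
    (hr.mapsToRestrict hrK) fun x => Subtype.ext (hfix x x.2)

end Retract

/-! ### Generation of the fundamental group -/

/-- The elements of `π₁(B, x)` represented by loops in `Y`. -/
def loopsIn {B : Type*} [TopologicalSpace B] (Y : Set B) {x : B} (hx : x ∈ Y) :
    Subgroup (FundamentalGroup B x) where
  carrier := {a | ∃ q : Path x x, range q ⊆ Y ∧ Path.Homotopic.Quotient.mk q = a}
  mul_mem' := by
    rintro _ _ ⟨p, hp, rfl⟩ ⟨q, hq, rfl⟩
    exact ⟨q.trans p, by rw [Path.trans_range]; exact union_subset hq hp, rfl⟩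
  one_mem' := ⟨Path.refl x, by simpa, rfl⟩
  inv_mem' := by
    rintro _ ⟨p, hp, rfl⟩
    exact ⟨p.symm, by rwa [Path.symm_range], rfl⟩

/-- Let `f : T → B` be a closed map from a locally path-connected space. If `B` is semilocally
simply connected and `c` is a choice of path classes from `x₀` that is compatible, modulo a
subgroup `S`, with the paths in `T`, then it is compatible with the paths in `range f`. -/
theorem mem_of_compatible {B T : Type*} [TopologicalSpace B] [TopologicalSpace T]
    [LocallyPathConnectedSpace T] (hB : SemilocallySimplyConnected B) (f : C(T, B))
    (hf : IsClosedMap f) {x₀ : B} (S : Subgroup (FundamentalGroup B x₀))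
    (c : ∀ y, Path.Homotopic.Quotient x₀ y)
    (hc : ∀ (t t' : T) (τ : Path t t'), (c (f t)).trans
      ((Path.Homotopic.Quotient.mk (τ.map f.continuous)).trans (c (f t')).symm) ∈ S)
    {a b : B} (q : Path a b) (hq : range q ⊆ range f) :
    (c a).trans ((Path.Homotopic.Quotient.mk q).trans (c b).symm) ∈ S := by
  have hloc : ∀ y : B, ∀ U ∈ 𝓝 y, ∀ᶠ y' in 𝓝 y, y' ∈ range f → ∃ p : Path y y',
      range p ⊆ U ∧ (c y).trans ((Path.Homotopic.Quotient.mk p).trans (c y').symm) ∈ S := by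
    intro y U hU
    have := hf.eventually_nhds_fiber (p := fun t' => ∃ p : Path y (f t'),
      range p ⊆ U ∧ (c y).trans ((Path.Homotopic.Quotient.mk p).trans (c (f t')).symm) ∈ S) y ?_
    · filter_upwards [this] with y' hy'
      rintro ⟨t', rfl⟩
      exact hy' t' rfl
    · rintro t rfl
      obtain ⟨W, ⟨hW, hWc⟩, hWU⟩ := (LocallyPathConnectedSpace.path_connected_basis t).mem_iff.1
        (f.continuous.continuousAt hU)
      filter_upwards [hW] with t' ht'
      obtain ⟨τ, hτ⟩ := hWc.joinedIn t (mem_of_mem_nhds hW) t' ht'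
      refine ⟨τ.map f.continuous, ?_, hc t t' τ⟩
      rintro _ ⟨s, rfl⟩
      exact hWU (hτ s)
  let P : I → I → Prop := fun s s' => ∃ u : Path s s',
    (c (q s)).trans ((Path.Homotopic.Quotient.mk (u.map q.continuous)).trans (c (q s')).symm) ∈ S
  have hsymm : Std.Symm P := ⟨fun s s' ⟨u, hu⟩ => ⟨u.symm, by
    have := symm_mem hu
    rw [quotient_trans_symm_rev, quotient_trans_symm_rev, quotient_symm_symm,
      Path.Homotopic.Quotient.trans_assoc, ← Path.Homotopic.Quotient.mk_symm] at this
    exact this⟩⟩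
  have htrans : IsTrans I P := ⟨fun s s' s'' ⟨u, hu⟩ ⟨u', hu'⟩ => ⟨u.trans u', by
    have := trans_mem hu hu'
    rw [Path.map_trans, Path.Homotopic.Quotient.mk_trans]
    simpa only [Path.Homotopic.Quotient.trans_assoc, quotient_symm_trans_cancel] using this⟩⟩
  obtain ⟨u, hu⟩ := PreconnectedSpace.induction₂ P (fun s => by
    obtain ⟨U, hU, hUp⟩ := hB (q s)
    obtain ⟨W, ⟨hW, hWc⟩, hWU⟩ := (LocallyPathConnectedSpace.path_connected_basis s).mem_iff.1
      (q.continuous.continuousAt hU)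
    filter_upwards [hW, q.continuous.continuousAt (hloc (q s) U hU)] with s' hs' hs''
    obtain ⟨u, hu⟩ := hWc.joinedIn s (mem_of_mem_nhds hW) s' hs'
    obtain ⟨p, hp, hpS⟩ := hs'' (hq ⟨s', rfl⟩)
    refine ⟨u, ?_⟩
    have : Path.Homotopic.Quotient.mk (u.map q.continuous) = Path.Homotopic.Quotient.mk p :=
      Path.Homotopic.Quotient.eq.2 (hUp _ _ _ _ (by rintro _ ⟨t, rfl⟩; exact hWU (hu t)) hp)
    rwa [this]) htrans 0 1
  have key : ∀ (a' b' : B) (ha : a' = a) (hb : b' = b) (q' : Path a' b')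
      (_ : (q'.cast ha.symm hb.symm).Homotopic q),
      (c a').trans ((Path.Homotopic.Quotient.mk q').trans (c b').symm) ∈ S →
      (c a).trans ((Path.Homotopic.Quotient.mk q).trans (c b).symm) ∈ S := by
    rintro _ _ rfl rfl q' h h'
    rwa [← Path.Homotopic.Quotient.eq.2 h]
  refine key _ _ q.source q.target _ ?_ hu
  have := ((SimplyConnectedSpace.paths_homotopic u Path.id).map ⟨q, q.continuous⟩).pathCast
    q.source.symm q.target.symm
  convert this using 1
  ext t
  rfl

theorem isClosedMap_of_sigma {ι B : Type*} [Finite ι] {T : ι → Type*} [∀ i, TopologicalSpace (T i)]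
    [TopologicalSpace B] {f : (Σ i, T i) → B} (hf : ∀ i, IsClosedMap fun t => f ⟨i, t⟩) :
    IsClosedMap f := by
  intro C hC
  have : f '' C = ⋃ i, (fun t => f ⟨i, t⟩) '' (Sigma.mk i ⁻¹' C) := by
    ext y; simp [Sigma.exists]
  rw [this]
  exact isClosed_iUnion_of_finite fun i => hf i _ (hC.preimage continuous_sigmaMk)

/-- Van Kampen's theorem, surjectivity part, for a finite closed cover. -/
theorem mem_of_closed_cover {B ι : Type*} [TopologicalSpace B] [PathConnectedSpace B] [Finite ι]
    (hB : SemilocallySimplyConnected B) (A : ι → Set B) (hA : ∀ i, IsClosed (A i))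
    [∀ i, LocallyPathConnectedSpace (A i)] {x₀ : B} (hx₀ : ∀ i, x₀ ∈ A i)
    (hj : ∀ i j, ∀ y ∈ A i ∩ A j, JoinedIn (A i ∩ A j) x₀ y)
    (S : Subgroup (FundamentalGroup B x₀)) (hS : ∀ i, loopsIn (A i) (hx₀ i) ≤ S)
    (q : Path x₀ x₀) (hq : range q ⊆ ⋃ i, A i) : Path.Homotopic.Quotient.mk q ∈ S := by
  have hc : ∀ y : B, ∃ p : Path x₀ y, y ∈ ⋃ i, A i → ∃ i, y ∈ A i ∧ range p ⊆ A i := by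
    intro y
    by_cases hy : y ∈ ⋃ i, A i
    · obtain ⟨i, hi⟩ := mem_iUnion.1 hy
      obtain ⟨p, hp⟩ := hj i i y ⟨hi, hi⟩
      exact ⟨p, fun _ => ⟨i, hi, by rintro _ ⟨t, rfl⟩; exact (hp t).1⟩⟩
    · exact ⟨PathConnectedSpace.somePath x₀ y, fun h => absurd h hy⟩
  choose c hc using hc
  have hcmp : ∀ i y, y ∈ A i → ∃ e : Path x₀ y, range e ⊆ A i ∧
      (Path.Homotopic.Quotient.mk (c y)).trans (Path.Homotopic.Quotient.mk e).symm ∈ S := by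
    intro i y hy
    obtain ⟨j, hyj, hj'⟩ := hc y (mem_iUnion_of_mem i hy)
    obtain ⟨e, he⟩ := hj i j y ⟨hy, hyj⟩
    refine ⟨e, by rintro _ ⟨t, rfl⟩; exact (he t).1, hS j ⟨(c y).trans e.symm, ?_, rfl⟩⟩
    rw [Path.trans_range, Path.symm_range]
    exact union_subset hj' (by rintro _ ⟨t, rfl⟩; exact (he t).2)
  let f : C(Σ i, A i, B) := ⟨fun t => (t.2 : B), continuous_sigma fun i => continuous_subtype_val⟩
  have hf : IsClosedMap f := isClosedMap_of_sigma fun i => (hA i).isClosedMap_subtype_val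
  have hfr : range f = ⋃ i, A i := by
    ext y; simp [f]
  have main := mem_of_compatible hB f hf S (fun y => Path.Homotopic.Quotient.mk (c y)) ?_ q (hfr ▸ hq)
  · obtain ⟨i, -⟩ : ∃ i, x₀ ∈ A i := mem_iUnion.1 (hq ⟨0, q.source⟩)
    obtain ⟨e, he, heS⟩ := hcmp i x₀ (hx₀ i)
    have hcx : Path.Homotopic.Quotient.mk (c x₀) ∈ S := by
      have := trans_mem heS (hS i ⟨e, he, rfl⟩)
      simpa only [Path.Homotopic.Quotient.trans_assoc, Path.Homotopic.Quotient.symm_trans,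
          Path.Homotopic.Quotient.trans_refl] using this
    have := trans_mem (trans_mem (symm_mem hcx) main) hcx
    simpa only [Path.Homotopic.Quotient.trans_assoc, Path.Homotopic.Quotient.symm_trans,
        Path.Homotopic.Quotient.trans_refl,
      quotient_symm_trans_cancel] using this
  · rintro t t' τ
    obtain ⟨i, K, -, hK⟩ := Sigma.isConnected_iff.1 (isConnected_range τ.continuous)
    have hτ : ∀ s, f (τ s) ∈ A i := fun s => by
      obtain ⟨z, -, hz⟩ := hK ▸ mem_range_self s
      rw [← hz]; exact z.2
    obtain ⟨e, he, heS⟩ := hcmp i (f t) (by simpa using hτ 0)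
    obtain ⟨e', he', heS'⟩ := hcmp i (f t') (by simpa using hτ 1)
    have hmid : (Path.Homotopic.Quotient.mk e).trans ((Path.Homotopic.Quotient.mk (τ.map f.continuous)).trans
        (Path.Homotopic.Quotient.mk e').symm) ∈ S := by
      refine hS i ⟨e.trans ((τ.map f.continuous).trans e'.symm), ?_, rfl⟩
      rw [Path.trans_range, Path.trans_range, Path.symm_range]
      refine union_subset he (union_subset ?_ he')
      rintro _ ⟨s, rfl⟩
      exact hτ s
    have := trans_mem heS (trans_mem hmid (symm_mem heS'))
    simpa only [Path.Homotopic.Quotient.trans_assoc, quotient_symm_trans_cancel,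
        quotient_trans_symm_rev,
      quotient_symm_symm] using this

/-! ### Covering spaces from two charts -/

section TwoCharts

universe u w

variable {B : Type u} {G : Type w} [TopologicalSpace B] [Group G] [TopologicalSpace G] [DiscreteTopology G]
  {U V : Set B} {c : B → G}

open Classical in
/-- The bundle with fibre `G` that is trivial over the open sets `U` (index `true`) and `V`
(index `false`), which are glued by left multiplication by the locally constant function `c`. -/
noncomputable def twoChartBundle (hU : IsOpen U) (hV : IsOpen V) (hUV : ∀ b, b ∈ U ∨ b ∈ V)
    (hc : ∀ b ∈ U ∩ V, ∀ᶠ b' in 𝓝 b, b' ∈ U ∩ V → c b' = c b) : FiberBundleCore Bool B G where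
  baseSet i := if i then U else V
  isOpen_baseSet i := by cases i <;> simpa
  indexAt b := decide (b ∈ U)
  mem_baseSet_at b := by
    by_cases h : b ∈ U
    · simp [h]
    · simpa [h] using (hUV b).resolve_left h
  coordChange i j b g := (if i then 1 else c b) * ((if j then 1 else (c b)⁻¹) * g)
  coordChange_self i b _ g := by cases i <;> simp
  continuousOn_coordChange i j := by
    rintro ⟨b, g⟩ ⟨hb, -⟩
    have hg : ∀ᶠ p : B × G in 𝓝 (b, g), p.2 = g :=
      (continuous_snd.tendsto (b, g)).eventually
        (by simp [nhds_discrete] : ∀ᶠ x in 𝓝 g, x = g)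
    refine (continuousWithinAt_const (b := (if i then 1 else c b) *
      ((if j then 1 else (c b)⁻¹) * g))).congr_of_eventuallyEq ?_ rfl
    cases i <;> cases j
    · filter_upwards [nhdsWithin_le_nhds hg] with p hp
      simp [hp]
    · have hcb := (continuous_fst.tendsto (b, g)).eventually (hc b ⟨hb.2, hb.1⟩)
      filter_upwards [nhdsWithin_le_nhds hg, nhdsWithin_le_nhds hcb, self_mem_nhdsWithin]
        with p hp hp' hp''
      simp [hp, hp' ⟨hp''.1.2, hp''.1.1⟩]
    · have hcb := (continuous_fst.tendsto (b, g)).eventually (hc b hb)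
      filter_upwards [nhdsWithin_le_nhds hg, nhdsWithin_le_nhds hcb, self_mem_nhdsWithin]
        with p hp hp' hp''
      simp [hp, hp' hp''.1]
    · filter_upwards [nhdsWithin_le_nhds hg] with p hp
      simp [hp]
  coordChange_comp i j k b _ g := by cases i <;> cases j <;> cases k <;> simp

/-- Loops that cross once from one chart to the other and back act on the fibre of the bundle
by left multiplications. -/
theorem exists_monodromy {ι : Type*} (hU : IsOpen U) (hV : IsOpen V) (hUV : ∀ b, b ∈ U ∨ b ∈ V)
    (hc : ∀ b ∈ U ∩ V, ∀ᶠ b' in 𝓝 b, b' ∈ U ∩ V → c b' = c b) {v : B}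
    (ℓ : ι → Path v v) (x : ι → G) (hℓU : ∀ i (s : I), ℓ i s ∈ U ↔ (s : ℝ) ≠ 1 / 2)
    (hℓV : ∀ i (s : I), 0 < s → s < 1 → ℓ i s ∈ V)
    (hc₁ : ∀ i (s : I), 0 < s → (s : ℝ) < 1 / 2 → c (ℓ i s) = 1)
    (hcx : ∀ i (s : I), 1 / 2 < (s : ℝ) → s < 1 → c (ℓ i s) = x i) :
    ∃ (Y : Type (max u w)) (Φ : FundamentalGroup B v →* Equiv.Perm Y) (e : G → Y),
        Function.Injective e ∧
      ∀ i g, Φ (Path.Homotopic.Quotient.mk (ℓ i)) (e g) = e (x i * g) := by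
  classical
  let Z := twoChartBundle hU hV hUV hc
  have cov : IsCoveringMap Z.proj := FiberBundle.isCoveringMap (F := G) (E := Z.Fiber)
  refine ⟨_, cov.monodromyPerm v, fun g => ⟨⟨v, g⟩, rfl⟩, fun g g' h => ?_, fun i g => ?_⟩
  · have h' : (⟨v, g⟩ : Z.TotalSpace) = ⟨v, g'⟩ := congrArg Subtype.val h
    exact eq_of_heq (Bundle.TotalSpace.mk.inj h').2
  have hsymm : ∀ (j : Bool) (g : G) (s : I), ℓ i s ∈ Z.baseSet j →
      ContinuousAt (fun t => (Z.localTriv j).toOpenPartialHomeomorph.symm (ℓ i t, g)) s := by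
    intro j g s hs
    have h1 : (ℓ i s, g) ∈ (Z.localTriv j).target := by
      rw [Z.mem_localTriv_target]; exact hs
    exact ContinuousAt.comp (f := fun t => (ℓ i t, g)) (x := s)
      ((Z.localTriv j).toOpenPartialHomeomorph.continuousAt_symm h1)
      ((ℓ i).continuous.continuousAt.prodMk continuousAt_const)
  have hZ : ∀ j : Bool, Z.baseSet j = if j then U else V := fun _ => rfl
  have hmk : ∀ (b b' : B) (g g' : G), b = b' → g = g' →
      (⟨b, g⟩ : Z.TotalSpace) = ⟨b', g'⟩ := by
    rintro b _ g _ rfl rfl; rfl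
  let Γ : I → Z.TotalSpace := fun s => ⟨ℓ i s, if (s : ℝ) ≤ 1 / 2 then g else x i * g⟩
  have hΓ : Continuous Γ := by
    rw [continuous_iff_continuousAt]
    intro s
    rcases lt_trichotomy (s : ℝ) (1 / 2) with hs | hs | hs
    · refine (hsymm true g s ?_).congr ?_
      · rw [hZ]; simpa using (hℓU i s).2 hs.ne
      · filter_upwards [continuous_subtype_val.continuousAt.eventually (gt_mem_nhds hs)] with t ht
        rw [Z.localTriv_symm_apply]
        have : ℓ i t ∈ U := (hℓU i t).2 ht.ne
        simp only [Γ, Z, twoChartBundle, this, ht.le]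
        simp
    · refine (hsymm false g s ?_).congr ?_
      · rw [hZ]; simpa using hℓV i s
          (show (0 : ℝ) < s by rw [hs]; norm_num) (show (s : ℝ) < 1 by rw [hs]; norm_num)
      · filter_upwards [continuous_subtype_val.continuousAt.eventually
          (lt_mem_nhds (by rw [hs]; norm_num : (0 : ℝ) < s)),
          continuous_subtype_val.continuousAt.eventually
          (gt_mem_nhds (by rw [hs]; norm_num : (s : ℝ) < 1))] with t ht ht'
        have ht0 : 0 < t := ht
        have ht1 : t < 1 := ht'
        rw [Z.localTriv_symm_apply]
        rcases lt_trichotomy (t : ℝ) (1 / 2) with h | h | h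
        · have h1 : ℓ i t ∈ U := (hℓU i t).2 h.ne
          simp only [Γ, Z, twoChartBundle, h1, h.le, hc₁ i t ht0 h]
          simp
        · have h1 : ℓ i t ∉ U := fun h' => (hℓU i t).1 h' h
          simp only [Γ, Z, twoChartBundle, h1, h.le]
          simp
        · have h1 : ℓ i t ∈ U := (hℓU i t).2 h.ne'
          simp only [Γ, Z, twoChartBundle, h1, h.not_ge, hcx i t h ht1]
          simp
    · refine (hsymm true (x i * g) s ?_).congr ?_
      · rw [hZ]; simpa using (hℓU i s).2 hs.ne'
      · filter_upwards [continuous_subtype_val.continuousAt.eventually (lt_mem_nhds hs)] with t ht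
        rw [Z.localTriv_symm_apply]
        have : ℓ i t ∈ U := (hℓU i t).2 ht.ne'
        simp only [Γ, Z, twoChartBundle, this, ht.not_ge]
        simp
  let γ : Path (⟨v, g⟩ : Z.TotalSpace) ⟨v, x i * g⟩ :=
    ⟨⟨Γ, hΓ⟩, hmk _ _ _ _ (ℓ i).source (by simp),
      hmk _ _ _ _ (ℓ i).target (if_neg (by norm_num))⟩
  have := cov.monodromy_map (Path.Homotopic.Quotient.mk γ)
  have hγ : Path.Homotopic.Quotient.mk (ℓ i) =
      (Path.Homotopic.Quotient.mk γ).map ⟨Z.proj, Z.continuous_proj⟩ :=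
    congrArg Path.Homotopic.Quotient.mk (Path.ext rfl)
  rw [IsCoveringMap.coe_monodromyPerm, hγ]
  exact this

end TwoCharts

/-! ### The fundamental group of a space with a spine -/

section Rose

variable {B : Type*} [TopologicalSpace B] {k : ℕ} {v : B} {ℓ : Fin k → Path v v}

theorem IsSpine.exists_retraction (h : IsSpine (univ : Set B) ℓ) :
    ∃ D : C(I × B, B), (∀ x, D (0, x) = x) ∧ (∀ x, D (1, x) ∈ roseSet ℓ) ∧
      ∀ (t : I), ∀ x ∈ roseSet ℓ, D (t, x) = x := by
  obtain ⟨D, h0, h1, h2⟩ := h.retract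
  refine ⟨⟨fun p => (D (p.1, ⟨p.2, mem_univ _⟩) : B), by fun_prop⟩, fun x => ?_, fun x => h1 _,
    fun t x hx => ?_⟩
  · simp [h0]
  · simp [h2 t ⟨x, mem_univ x⟩ hx]

theorem IsSpine.eq_of_apply_eq {H : Set B} (h : IsSpine H ℓ) {i j : Fin k} {s t : I} (hs0 : s ≠ 0)
    (hs1 : s ≠ 1) (he : ℓ i s = ℓ j t) : i = j ∧ s = t := by
  rcases h.embedded i j s t he with h' | ⟨h' | h', -⟩
  exacts [h', absurd h' hs0, absurd h' hs1]

theorem IsSpine.ne_vertex {H : Set B} (h : IsSpine H ℓ) {i : Fin k} {s : I} (hs0 : s ≠ 0)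
    (hs1 : s ≠ 1) : ℓ i s ≠ v := by
  intro he
  exact hs0 (h.eq_of_apply_eq (j := i) (t := 0) hs0 hs1 (by rw [he, (ℓ i).source])).2

theorem mem_roseSet (i : Fin k) (s : I) : ℓ i s ∈ roseSet ℓ :=
  Or.inr (mem_iUnion.2 ⟨i, s, rfl⟩)

theorem exists_of_mem_roseSet {y : B} (hy : y ∈ roseSet ℓ) (hv : y ≠ v) : ∃ i s, ℓ i s = y := by
  rcases hy with hy | hy
  · exact absurd hy hv
  · obtain ⟨i, s, hs⟩ := mem_iUnion.1 hy
    exact ⟨i, s, hs⟩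

theorem IsSpine.pathConnectedSpace (h : IsSpine (univ : Set B) ℓ) : PathConnectedSpace B := by
  obtain ⟨D, h0, h1, -⟩ := h.exists_retraction
  have key : ∀ x, Joined v x := by
    intro x
    have hx : Joined x (D (1, x)) := ⟨⟨⟨fun t => D (t, x), by fun_prop⟩, h0 x, rfl⟩⟩
    refine Joined.trans ?_ hx.symm
    by_cases hv : D (1, x) = v
    · rw [hv]
    · obtain ⟨i, s, hs⟩ := exists_of_mem_roseSet (h1 x) hv
      rw [← hs]
      exact ⟨((PathConnectedSpace.somePath 0 s).map (ℓ i).continuous).cast (ℓ i).source.symm rfl⟩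
  exact ⟨⟨v⟩, fun x y => (key x).symm.trans (key y)⟩

/-- A half of a petal of a rose is relatively open in the rose, away from its end points. -/
theorem IsSpine.eventually_mem_petal [T2Space B] {H : Set B} (h : IsSpine H ℓ) {W : Set I}
    (hW : IsOpen W) (h0 : 0 ∉ W) (h1 : 1 ∉ W) (i : Fin k) {s : I} (hs : s ∈ W) :
    ∀ᶠ y in 𝓝 (ℓ i s), y ∈ roseSet ℓ → ∃ t ∈ W, y = ℓ i t := by
  have hs0 : s ≠ 0 := fun h => h0 (h ▸ hs)
  have hs1 : s ≠ 1 := fun h => h1 (h ▸ hs)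
  have hK : IsClosed ((⋃ j ∈ {j | j ≠ i}, range (ℓ j)) ∪ ℓ i '' Wᶜ) := by
    refine ((Set.toFinite _).isClosed_biUnion fun j _ => ?_).union ?_
    · exact (isCompact_range (ℓ j).continuous).isClosed
    · exact (hW.isClosed_compl.isCompact.image (ℓ i).continuous).isClosed
  have hsK : ℓ i s ∉ (⋃ j ∈ {j | j ≠ i}, range (ℓ j)) ∪ ℓ i '' Wᶜ := by
    rintro (hm | ⟨t, ht, hst⟩)
    · obtain ⟨j, hj, t, ht⟩ := mem_iUnion₂.1 hm
      exact hj (h.eq_of_apply_eq hs0 hs1 ht.symm).1.symm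
    · exact ht ((h.eq_of_apply_eq hs0 hs1 hst.symm).2 ▸ hs)
  filter_upwards [hK.isOpen_compl.mem_nhds hsK] with y hy hyR
  have hyv : y ≠ v := by
    rintro rfl
    exact hy (Or.inr ⟨0, h0, (ℓ i).source⟩)
  obtain ⟨j, t, rfl⟩ := exists_of_mem_roseSet hyR hyv
  obtain rfl : j = i := by
    by_contra hj
    exact hy (Or.inl (mem_iUnion₂.2 ⟨j, hj, t, rfl⟩))
  exact ⟨t, by_contra fun ht => hy (Or.inr ⟨t, ht, rfl⟩), rfl⟩

/-- The homotopy classes of the edges of a spine. -/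
abbrev edgeClass (ℓ : Fin k → Path v v) (i : Fin k) : FundamentalGroup B v :=
  Path.Homotopic.Quotient.mk (ℓ i)

theorem IsSpine.lift_injective [T2Space B] (h : IsSpine (univ : Set B) ℓ) :
    Function.Injective (FreeGroup.lift (edgeClass ℓ)) := by
  classical
  obtain ⟨D, -, hD1, hDfix⟩ := h.exists_retraction
  let r : B → B := fun x => D (1, x)
  have hr : Continuous r := by fun_prop
  have hrℓ : ∀ i s, r (ℓ i s) = ℓ i s := fun i s => hDfix 1 _ (mem_roseSet i s)
  let m : I := ⟨1 / 2, by norm_num, by norm_num⟩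
  have hm0 : m ≠ 0 := fun h => by simpa [m] using congrArg Subtype.val h
  have hm1 : m ≠ 1 := fun h => by
    have := congrArg Subtype.val h
    norm_num [m] at this
  let A : Fin k → Set B := fun i => {b | ∃ s : I, 1 / 2 < (s : ℝ) ∧ s < 1 ∧ r b = ℓ i s}
  let c : B → FreeGroup (Fin k) := fun b =>
    if hb : ∃ i, b ∈ A i then FreeGroup.of hb.choose else 1
  have hAu : ∀ b i j, b ∈ A i → b ∈ A j → i = j := by
    rintro b i j ⟨s, hs, hs1, hb⟩ ⟨t, -, -, hb'⟩
    refine (h.eq_of_apply_eq ?_ hs1.ne (hb.symm.trans hb')).1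
    rintro rfl
    norm_num at hs
  have hcA : ∀ b i, b ∈ A i → c b = FreeGroup.of i := by
    intro b i hb
    have hex : ∃ i, b ∈ A i := ⟨i, hb⟩
    simp only [c, dif_pos hex]
    rw [hAu b _ _ hex.choose_spec hb]
  have hc1 : ∀ b i (s : I), 0 < s → (s : ℝ) < 1 / 2 → r b = ℓ i s → c b = 1 := by
    intro b i s hs0 hs hb
    refine dif_neg ?_
    rintro ⟨j, t, ht, ht1, hbt⟩
    have := (h.eq_of_apply_eq (i := i) (j := j) (s := s) (t := t) hs0.ne' (by
      rintro rfl; norm_num at hs) (hb.symm.trans hbt)).2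
    subst this
    exact lt_asymm ht hs
  let U : Set B := {b | ∀ i, r b ≠ ℓ i m}
  let V : Set B := {b | r b ≠ v}
  have hU : IsOpen U := by
    have : U = ⋂ i, r ⁻¹' {ℓ i m}ᶜ := by ext; simp [U]
    rw [this]
    exact isOpen_iInter_of_finite fun i => isOpen_compl_singleton.preimage hr
  have hV : IsOpen V := isOpen_compl_singleton.preimage hr
  have hUV : ∀ b, b ∈ U ∨ b ∈ V := by
    intro b
    by_cases hb : r b = v
    · exact Or.inl fun i hi => h.ne_vertex hm0 hm1 (hi.symm.trans hb)
    · exact Or.inr hb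
  have hc : ∀ b ∈ U ∩ V, ∀ᶠ b' in 𝓝 b, b' ∈ U ∩ V → c b' = c b := by
    rintro b ⟨hbU, hbV⟩
    obtain ⟨i, s, hs⟩ := exists_of_mem_roseSet (hD1 b) hbV
    have hs0 : s ≠ 0 := by
      rintro rfl; exact hbV (hs.symm.trans (ℓ i).source)
    have hs1 : s ≠ 1 := by
      rintro rfl; exact hbV (hs.symm.trans (ℓ i).target)
    have hs0' : 0 < s := lt_of_le_of_ne s.2.1 hs0.symm
    have hs1' : s < 1 := lt_of_le_of_ne s.2.2 hs1
    have hsm : (s : ℝ) ≠ 1 / 2 := by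
      intro hsm
      obtain rfl : s = m := Subtype.ext hsm
      exact hbU i hs.symm
    have hpet : ∀ W : Set I, IsOpen W → 0 ∉ W → 1 ∉ W → s ∈ W →
        ∀ᶠ b' in 𝓝 b, ∃ t ∈ W, r b' = ℓ i t := by
      intro W hW h0 h1 hsW
      have := h.eventually_mem_petal hW h0 h1 i hsW
      rw [hs] at this
      filter_upwards [hr.continuousAt.eventually this] with b' hb'
      exact hb' (hD1 b')
    rcases lt_or_gt_of_ne hsm with hlt | hgt
    · rw [hc1 b i s hs0' hlt hs.symm]
      filter_upwards [hpet {t : I | 0 < t ∧ (t : ℝ) < 1 / 2}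
        ((isOpen_lt continuous_const continuous_id).inter
          (isOpen_lt continuous_subtype_val continuous_const))
        (by simp) (fun h => by norm_num at h) ⟨hs0', hlt⟩] with b' hb' _
      obtain ⟨t, ht, hbt⟩ := hb'
      exact hc1 b' i t ht.1 ht.2 hbt
    · rw [hcA b i ⟨s, hgt, hs1', hs.symm⟩]
      filter_upwards [hpet {t : I | 1 / 2 < (t : ℝ) ∧ t < 1}
        ((isOpen_lt continuous_const continuous_subtype_val).inter
          (isOpen_gt' (1 : I)))
        (fun h => by norm_num at h) (by simp) ⟨hgt, hs1'⟩] with b' hb' _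
      obtain ⟨t, ht, hbt⟩ := hb'
      exact hcA b' i ⟨t, ht.1, ht.2, hbt⟩
  let _ : TopologicalSpace (FreeGroup (Fin k)) := ⊥
  have : DiscreteTopology (FreeGroup (Fin k)) := ⟨rfl⟩
  obtain ⟨Y, Φ, e, he, hΦ⟩ := exists_monodromy hU hV hUV hc
    ℓ FreeGroup.of
    (fun i s => by
      constructor
      · intro hsU hs
        obtain rfl : s = m := Subtype.ext hs
        exact hsU i (hrℓ i m)
      · intro hs j hj
        rw [hrℓ] at hj
        exact hs (congrArg Subtype.val (h.eq_of_apply_eq hm0 hm1 hj.symm).2.symm))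
    (fun i s hs0 hs1 hs => h.ne_vertex hs0.ne' hs1.ne ((hrℓ i s).symm.trans hs))
    (fun i s hs0 hs => hc1 _ i s hs0 hs (hrℓ i s))
    (fun i s hs hs1 => hcA _ i ⟨s, hs, hs1, hrℓ i s⟩)
  have main : ∀ w g, Φ (FreeGroup.lift (edgeClass ℓ) w) (e g) = e (w * g) := by
    intro w
    induction w using FreeGroup.induction_on with
    | C1 => intro g; rw [map_one, map_one, one_mul]; rfl
    | of i => intro g; simpa using hΦ i g
    | inv_of i _ =>
      intro g
      rw [map_inv, map_inv, Equiv.Perm.inv_eq_iff_eq]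
      simpa using (hΦ i ((FreeGroup.of i)⁻¹ * g)).symm
    | mul w w' hw hw' => intro g; rw [map_mul, map_mul, Equiv.Perm.mul_apply, hw', hw, mul_assoc]
  intro w w' hww
  have := main w 1
  rw [hww, main w' 1] at this
  simpa using (he this).symm

theorem homotopic_of_factor (g : C(I, B)) {a b : B} (e e' : Path a b) {s s' : I} (u u' : Path s s')
    (he : ∀ t, e t = g (u t)) (he' : ∀ t, e' t = g (u' t)) : e.Homotopic e' := by
  obtain rfl : a = g s := by simpa using he 0
  obtain rfl : b = g s' := by simpa using he 1
  have h1 : e = u.map g.continuous := Path.ext (funext he)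
  have h2 : e' = u'.map g.continuous := Path.ext (funext he')
  rw [h1, h2]
  exact (SimplyConnectedSpace.paths_homotopic u u').map g

theorem IsSpine.closure_edgeClass [T2Space B] (hB : SemilocallySimplyConnected B)
    (h : IsSpine (univ : Set B) ℓ) : Subgroup.closure (range (edgeClass ℓ)) = ⊤ := by
  have := h.pathConnectedSpace
  set S := Subgroup.closure (range (edgeClass ℓ)) with hS
  let ℓ' : Option (Fin k) → Path v v := fun o => o.elim (Path.refl v) ℓ
  have hℓ'S : ∀ o, Path.Homotopic.Quotient.mk (ℓ' o) ∈ S := by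
    rintro (_ | i)
    · exact refl_mem S
    · exact Subgroup.subset_closure ⟨i, rfl⟩
  have hR : roseSet ℓ = ⋃ o, range (ℓ' o) := by
    ext y
    simp only [roseSet, iUnion_option, ℓ', Option.elim_none, Option.elim_some, Path.refl_range]
  have hend : ∀ (e : Path v v) o s (u : Path 0 s), (∀ t, e t = ℓ' o (u t)) →
      (s = 0 ∨ s = 1 ∨ o = none) → Path.Homotopic.Quotient.mk e ∈ S := by
    rintro e o s u he (rfl | rfl | rfl)
    · rw [Path.Homotopic.Quotient.eq.2 (homotopic_of_factor ⟨ℓ' o, (ℓ' o).continuous⟩ e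
        (Path.refl v) u (Path.refl 0) he (fun t => by simp))]
      exact refl_mem S
    · rw [Path.Homotopic.Quotient.eq.2 (homotopic_of_factor ⟨ℓ' o, (ℓ' o).continuous⟩ e
        (ℓ' o) u Path.id he (fun t => rfl))]
      exact hℓ'S o
    · have : e = Path.refl v := Path.ext (funext fun t => by rw [he]; rfl)
      rw [this]
      exact refl_mem S
  have hc : ∀ y : B, ∃ p : Path v y, y ∈ roseSet ℓ → ∃ o s, ∃ u : Path 0 s,
      ∀ t, p t = ℓ' o (u t) := by
    intro y
    by_cases hy : y ∈ roseSet ℓ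
    · rw [hR] at hy
      obtain ⟨o, s, rfl⟩ := mem_iUnion.1 hy
      exact ⟨((PathConnectedSpace.somePath 0 s).map (ℓ' o).continuous).cast (ℓ' o).source.symm rfl,
        fun _ => ⟨o, s, _, fun t => rfl⟩⟩
    · exact ⟨PathConnectedSpace.somePath v y, fun h => absurd h hy⟩
  choose c hc using hc
  have hcmp : ∀ y (e : Path v y) i s (u : Path 0 s), (∀ t, e t = ℓ' i (u t)) →
      (Path.Homotopic.Quotient.mk (c y)).trans (Path.Homotopic.Quotient.mk e).symm ∈ S := by
    intro y e i s u he
    have hy : y = ℓ' i s := by simpa using he 1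
    obtain ⟨o, s', u', hu'⟩ := hc y (hR ▸ mem_iUnion.2 ⟨i, s, hy.symm⟩)
    have hy' : y = ℓ' o s' := by simpa using hu' 1
    by_cases hyv : y = v
    · subst hyv
      have hcase : ∀ o s, y = ℓ' o s → (s = 0 ∨ s = 1 ∨ o = none) := by
        rintro (_ | j) s hs
        · simp
        · by_contra! hne
          exact h.ne_vertex hne.1 hne.2.1 hs.symm
      exact trans_mem (hend _ o s' u' hu' (hcase _ _ hy'))
        (symm_mem (hend _ i s u he (hcase _ _ hy)))
    · obtain ⟨rfl, rfl⟩ : i = o ∧ s = s' := by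
        rcases i with _ | i
        · exact absurd hy hyv
        rcases o with _ | o
        · exact absurd hy' hyv
        have := h.eq_of_apply_eq (i := i) (j := o) (s := s) (t := s')
          (by rintro rfl; exact hyv (hy.trans (ℓ i).source))
          (by rintro rfl; exact hyv (hy.trans (ℓ i).target)) (hy.symm.trans hy')
        simpa using this
      rw [Path.Homotopic.Quotient.eq.2 (homotopic_of_factor ⟨ℓ' i, (ℓ' i).continuous⟩ (c y) e
        u' u hu' he), Path.Homotopic.Quotient.trans_symm]
      exact refl_mem S
  let f : C(Σ _ : Option (Fin k), I, B) :=
    ⟨fun t => ℓ' t.1 t.2, continuous_sigma fun o => (ℓ' o).continuous⟩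
  have hf : IsClosedMap f := isClosedMap_of_sigma fun o => (ℓ' o).continuous.isClosedMap
  have hfr : range f = roseSet ℓ := by
    rw [hR]; ext y; simp [f]
  have hcomp := mem_of_compatible (a := v) (b := v) hB f hf S (fun y => Path.Homotopic.Quotient.mk (c y)) (by
    intro t t' τ
    obtain ⟨i, K, -, hK⟩ := Sigma.isConnected_iff.1 (isConnected_range τ.continuous)
    have hτ1 : ∀ s, (τ s).1 = i := fun s => by
      obtain ⟨z, -, hz⟩ := hK ▸ mem_range_self s
      rw [← hz]
    have hsnd : Continuous fun t : Σ _ : Option (Fin k), I => t.2 :=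
      continuous_sigma fun _ => continuous_id
    let τ₂ : Path t.2 t'.2 := ⟨⟨fun s => (τ s).2, hsnd.comp τ.continuous⟩, by simp, by simp⟩
    have hτ : ∀ s, f (τ s) = ℓ' i (τ₂ s) := fun s => by
      show ℓ' (τ s).1 (τ s).2 = _
      rw [hτ1]; rfl
    let u : Path 0 t.2 := PathConnectedSpace.somePath 0 t.2
    have ht : f t = ℓ' i t.2 := by simpa using hτ 0
    let e : Path v (f t) := (u.map (ℓ' i).continuous).cast (ℓ' i).source.symm ht
    have h1 := hcmp (f t) e i t.2 u fun s => rfl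
    have h2 := hcmp (f t') (e.trans (τ.map f.continuous)) i t'.2 (u.trans τ₂) fun s => by
      have : (e.trans (τ.map f.continuous)) s =
          ((u.map (ℓ' i).continuous).trans (τ₂.map (ℓ' i).continuous)) s := by
        rw [Path.trans_apply, Path.trans_apply]
        split_ifs
        · rfl
        · exact hτ _
      rw [this, ← Path.map_trans]
      rfl
    have := trans_mem h1 (symm_mem h2)
    rw [Path.Homotopic.Quotient.mk_trans] at this
    simpa only [Path.Homotopic.Quotient.trans_assoc, quotient_symm_trans_cancel,
      quotient_trans_symm_rev, quotient_symm_symm] using this)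
  rw [eq_top_iff]
  rintro a -
  obtain ⟨q, rfl⟩ := Path.Homotopic.Quotient.mk_surjective a
  obtain ⟨D, hD0, hD1, hDfix⟩ := h.exists_retraction
  have hvR : v ∈ roseSet ℓ := Or.inl rfl
  let q' : Path v v := ⟨⟨fun t => D (1, q t), by fun_prop⟩, by simp [hDfix 1 v hvR],
    by simp [hDfix 1 v hvR]⟩
  have hqq' : q.Homotopic q' := by
    refine ⟨⟨⟨⟨fun x : I × I => D (x.1, q x.2), by fun_prop⟩, fun s => hD0 _, fun s => rfl⟩, ?_⟩⟩
    rintro t s (rfl | rfl)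
    · simp [hDfix t v hvR]
    · simp [hDfix t v hvR]
  have hcv := hcmp v (Path.refl v) none 0 (Path.refl 0) fun t => rfl
  rw [Path.Homotopic.Quotient.mk_refl, quotient_refl_symm,
    Path.Homotopic.Quotient.trans_refl] at hcv
  have hmem := hcomp q' (by rintro _ ⟨t, rfl⟩; rw [hfr]; exact hD1 _)
  have := trans_mem (trans_mem (symm_mem hcv) hmem) hcv
  rw [Path.Homotopic.Quotient.eq.2 hqq']
  simpa only [Path.Homotopic.Quotient.trans_assoc, Path.Homotopic.Quotient.symm_trans,
    Path.Homotopic.Quotient.trans_refl, quotient_symm_trans_cancel] using this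

theorem IsSpine.lift_bijective [T2Space B] (hB : SemilocallySimplyConnected B)
    (h : IsSpine (univ : Set B) ℓ) : Function.Bijective (FreeGroup.lift (edgeClass ℓ)) := by
  refine ⟨h.lift_injective, MonoidHom.range_eq_top.1 ?_⟩
  rw [FreeGroup.range_lift_eq_closure, h.closure_edgeClass hB]

end Rose

/-! ### Nielsen equivalence -/

section Nielsen

variable {G G' : Type*} [Group G] [Group G'] {n : ℕ} {a b c : Fin n → G}

theorem nielsenEquiv_iff : NielsenEquiv a b ↔
    ∃ Y : FreeGroup (Fin n) ≃* FreeGroup (Fin n), ∀ i,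
      FreeGroup.lift a (Y (FreeGroup.of i)) = b i := by
  constructor
  · rintro ⟨y, φ, ha, hb⟩
    have : φ = FreeGroup.lift a := by ext i; simp [ha]
    subst this
    exact ⟨y.repr.symm, fun i => hb i⟩
  · rintro ⟨Y, hY⟩
    exact ⟨FreeGroupBasis.ofRepr Y.symm, FreeGroup.lift a, fun i => by simp, fun i => hY i⟩

theorem NielsenEquiv.trans (hab : NielsenEquiv a b) (hbc : NielsenEquiv b c) :
    NielsenEquiv a c := by
  obtain ⟨Y, hY⟩ := nielsenEquiv_iff.1 hab
  obtain ⟨Z, hZ⟩ := nielsenEquiv_iff.1 hbc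
  refine nielsenEquiv_iff.2 ⟨Z.trans Y, fun i => ?_⟩
  have : (FreeGroup.lift a).comp Y.toMonoidHom = FreeGroup.lift b := by
    ext i; simpa using hY i
  rw [← hZ, ← this]
  rfl

theorem NielsenEquiv.map (h : NielsenEquiv a b) (Φ : G →* G') :
    NielsenEquiv (fun i => Φ (a i)) (fun i => Φ (b i)) := by
  obtain ⟨y, φ, ha, hb⟩ := h
  exact ⟨y, Φ.comp φ, fun i => by simp [ha], fun i => by simp [hb]⟩

theorem NielsenEquiv.exists_of_map {Φ : G →* G'} {b : Fin n → G'}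
    (h : NielsenEquiv (fun i => Φ (a i)) b) :
    ∃ b' : Fin n → G, NielsenEquiv a b' ∧ (fun i => Φ (b' i)) = b := by
  obtain ⟨y, φ, ha, hb⟩ := h
  refine ⟨fun i => FreeGroup.lift a (y i), ⟨y, FreeGroup.lift a, fun i => by simp, fun i => rfl⟩,
    funext fun i => ?_⟩
  have : φ = Φ.comp (FreeGroup.lift a) := by ext i; simp [ha]
  rw [← hb, this]
  rfl

theorem nielsenEquiv_of_bijective (ha : Function.Bijective (FreeGroup.lift a))
    (hb : Function.Bijective (FreeGroup.lift b)) : NielsenEquiv a b := by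
  refine nielsenEquiv_iff.2 ⟨(MulEquiv.ofBijective _ hb).trans (MulEquiv.ofBijective _ ha).symm,
    fun i => ?_⟩
  simp

theorem nielsenEquiv_conj (ha : Subgroup.closure (range a) = ⊤) (g : G) :
    NielsenEquiv a (fun i => g * a i * g⁻¹) := by
  rw [← FreeGroup.range_lift_eq_closure, MonoidHom.range_eq_top] at ha
  obtain ⟨w, rfl⟩ := ha g
  exact nielsenEquiv_iff.2 ⟨MulAut.conj w, fun i => by simp⟩

end Nielsen

/-! ### Change of base point -/

section BasePoint

variable {M N : Type*} [TopologicalSpace M] [TopologicalSpace N] {k : ℕ}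

/-- The isomorphism `a ↦ β a β⁻¹` of fundamental groups induced by a path `β`. -/
noncomputable def conjPath {x y : M} (β : Path x y) :
    FundamentalGroup M y ≃* FundamentalGroup M x :=
  FundamentalGroup.fundamentalGroupMulEquivOfPath β.symm

theorem conjPath_apply {x y : M} (β : Path x y) (a : FundamentalGroup M y) :
    conjPath β a = (Path.Homotopic.Quotient.mk β).trans
      (Path.Homotopic.Quotient.trans a (Path.Homotopic.Quotient.mk β).symm) := by
  have : conjPath β a = (Path.Homotopic.Quotient.mk β.symm).symm.trans
      (Path.Homotopic.Quotient.trans a (Path.Homotopic.Quotient.mk β.symm)) := rfl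
  rw [this, Path.Homotopic.Quotient.mk_symm, quotient_symm_symm]

theorem loopClasses_apply {x₀ v : M} (γ : Path x₀ v) (ℓ : Fin k → Path v v) (i : Fin k) :
    loopClasses γ ℓ i = conjPath γ (edgeClass ℓ i) := by
  rw [conjPath_apply]
  show Path.Homotopic.Quotient.mk ((γ.trans (ℓ i)).trans γ.symm) = _
  rw [Path.Homotopic.Quotient.mk_trans, Path.Homotopic.Quotient.mk_trans,
    Path.Homotopic.Quotient.mk_symm, Path.Homotopic.Quotient.trans_assoc]

theorem conjPath_trans {x y z : M} (β : Path x y) (γ : Path y z) (a : FundamentalGroup M z) :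
    conjPath (β.trans γ) a = conjPath β (conjPath γ a) := by
  simp only [conjPath_apply, Path.Homotopic.Quotient.mk_trans, quotient_trans_symm_rev,
    Path.Homotopic.Quotient.trans_assoc]

theorem conjPath_symm {x y : M} (β : Path x y) (a : FundamentalGroup M x) :
    conjPath β (conjPath β.symm a) = a := by
  simp only [conjPath_apply, Path.Homotopic.Quotient.mk_symm, quotient_symm_symm,
    Path.Homotopic.Quotient.trans_assoc, Path.Homotopic.Quotient.trans_symm,
    Path.Homotopic.Quotient.trans_refl, quotient_trans_symm_cancel]

theorem map_conjPath (f : C(M, N)) {x y : M} (β : Path x y) (a : FundamentalGroup M y) :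
    FundamentalGroup.map f x (conjPath β a) =
      conjPath (β.map f.continuous) (FundamentalGroup.map f y a) := by
  rw [conjPath_apply, conjPath_apply]
  show Path.Homotopic.Quotient.map _ f = _
  rw [quotient_map_trans, quotient_map_trans, quotient_map_symm]
  rfl

theorem nielsenClass_conjPath (H : Set M) {x y : M} (β : Path x y) :
    (fun (a : Fin k → FundamentalGroup M y) j => conjPath β (a j)) '' nielsenClass k H y =
      nielsenClass k H x := by
  have key : ∀ {x y : M} (β : Path x y), ∀ b ∈ nielsenClass k H y,
      (fun j => conjPath β (b j)) ∈ nielsenClass k H x := by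
    rintro x y β b ⟨v, ℓ, γ, hℓ, hb⟩
    refine ⟨v, ℓ, β.trans γ, hℓ, ?_⟩
    have : NielsenEquiv (fun i => conjPath β (loopClasses γ ℓ i)) fun i => conjPath β (b i) :=
      hb.map (conjPath β).toMonoidHom
    convert this using 1
    funext i
    rw [loopClasses_apply, loopClasses_apply, conjPath_trans]
  refine Subset.antisymm (image_subset_iff.2 fun b hb => key β b hb) fun b hb => ?_
  exact ⟨_, key β.symm b hb, funext fun j => conjPath_symm β (b j)⟩

/-! ### Spines and embeddings -/

theorem IsSpine.cast {H : Set M} {v v' : M} {ℓ : Fin k → Path v v} (h : IsSpine H ℓ)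
    (hv : v' = v) : IsSpine H fun i => (ℓ i).cast hv hv := by
  subst hv; exact h

theorem roseSet_map {f : M → N} (hf : Continuous f) {v : M} (ℓ : Fin k → Path v v) :
    roseSet (fun i => (ℓ i).map hf) = f '' roseSet ℓ := by
  simp only [roseSet, image_union, image_singleton, image_iUnion, ← range_comp]
  rfl

theorem IsSpine.image {f : M → N} (hf : IsEmbedding f) {H : Set M} {v : M}
    {ℓ : Fin k → Path v v} (h : IsSpine H ℓ) :
    IsSpine (f '' H) fun i => (ℓ i).map hf.continuous where
  subset := by
    rw [roseSet_map]
    exact image_mono h.subset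
  embedded i j s t hst := h.embedded i j s t (hf.injective hst)
  retract := by
    obtain ⟨D, h0, h1, h2⟩ := h.retract
    let e : H ≃ₜ f '' H := hf.homeomorphImage H
    have he : ∀ x : H, (e x : N) = f x := fun x => rfl
    have he' : ∀ x : f '' H, f (e.symm x) = x := fun x => by
      rw [← he, e.apply_symm_apply]
    refine ⟨⟨fun p => e (D (p.1, e.symm p.2)), by fun_prop⟩, fun x => ?_, fun x => ?_,
      fun t x hx => ?_⟩
    · simp [h0]
    · rw [roseSet_map]
      exact ⟨_, h1 (e.symm x), rfl⟩
    · rw [roseSet_map] at hx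
      obtain ⟨y, hy, hyx⟩ := hx
      have : (e.symm x : M) = y := hf.injective ((he' x).trans hyx.symm)
      show e (D (t, e.symm x)) = x
      rw [h2 t (e.symm x) (this ▸ hy), e.apply_symm_apply]

/-- A path in a subset, as a path in the subspace. -/
def pathToSubtype {H : Set M} {x y : M} (p : Path x y) (hp : range p ⊆ H) :
    Path (⟨x, hp ⟨0, p.source⟩⟩ : H) ⟨y, hp ⟨1, p.target⟩⟩ where
  toFun t := ⟨p t, hp ⟨t, rfl⟩⟩
  continuous_toFun := p.continuous.subtype_mk _
  source' := Subtype.ext p.source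
  target' := Subtype.ext p.target

theorem IsSpine.exists_subtype {H : Set M} {v : M} {ℓ : Fin k → Path v v} (h : IsSpine H ℓ) :
    ∃ (hv : v ∈ H) (ℓ' : Fin k → Path (⟨v, hv⟩ : H) ⟨v, hv⟩),
      (∀ i, (ℓ' i).map continuous_subtype_val = ℓ i) ∧ IsSpine univ ℓ' := by
  have hv : v ∈ H := h.subset (Or.inl rfl)
  have hr : ∀ i, range (ℓ i) ⊆ H := fun i => by
    rintro _ ⟨t, rfl⟩
    exact h.subset (mem_roseSet i t)
  let ℓ' : Fin k → Path (⟨v, hv⟩ : H) ⟨v, hv⟩ := fun i => pathToSubtype (ℓ i) (hr i)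
  have hrose : ∀ x : H, x ∈ roseSet ℓ' ↔ (x : M) ∈ roseSet ℓ := fun x => by
    simp [roseSet, ℓ', pathToSubtype, Subtype.ext_iff]
  refine ⟨hv, ℓ', fun i => rfl, subset_univ _,
    fun i j s t hst => h.embedded i j s t (congrArg Subtype.val hst), ?_⟩
  obtain ⟨D, h0, h1, h2⟩ := h.retract
  refine ⟨⟨fun p => ⟨D (p.1, p.2), mem_univ _⟩, by fun_prop⟩, fun x => ?_, fun x => ?_,
    fun t x hx => ?_⟩
  · simp [h0]
  · exact (hrose _).2 (h1 x)
  · exact Subtype.ext (h2 t x ((hrose _).1 hx))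

theorem IsSpine.joinedIn {H : Set M} {v : M} {ℓ : Fin k → Path v v} (h : IsSpine H ℓ) {x y : M}
    (hx : x ∈ H) (hy : y ∈ H) : JoinedIn H x y := by
  obtain ⟨hv, ℓ', -, hℓ'⟩ := h.exists_subtype
  have := hℓ'.pathConnectedSpace
  exact ⟨(PathConnectedSpace.somePath (⟨x, hx⟩ : H) ⟨y, hy⟩).map continuous_subtype_val,
    fun t => Subtype.coe_prop _⟩

/-! ### Homeomorphisms and isotopies -/

theorem map_bijective (f : M ≃ₜ N) (x : M) :
    Function.Bijective (FundamentalGroup.map (⟨f, f.continuous⟩ : C(M, N)) x) := by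
  have hx : x = f.symm (f x) := (f.symm_apply_apply x).symm
  constructor
  · intro a b hab
    obtain ⟨p, rfl⟩ := Path.Homotopic.Quotient.mk_surjective a
    obtain ⟨q, rfl⟩ := Path.Homotopic.Quotient.mk_surjective b
    have h : (p.map f.continuous).Homotopic (q.map f.continuous) :=
      Path.Homotopic.Quotient.exact hab
    have := (h.map ⟨f.symm, f.symm.continuous⟩).pathCast hx hx
    refine Path.Homotopic.Quotient.eq.2 ?_
    convert this <;> ext t <;> simp
  · intro b
    obtain ⟨q, rfl⟩ := Path.Homotopic.Quotient.mk_surjective b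
    refine ⟨Path.Homotopic.Quotient.mk ((q.map f.symm.continuous).cast hx hx), ?_⟩
    exact congrArg Path.Homotopic.Quotient.mk (Path.ext (funext fun t => f.apply_symm_apply _))

theorem map_loopClasses (f : C(M, N)) {x v : M} (γ : Path x v) (ℓ : Fin k → Path v v) (i : Fin k) :
    FundamentalGroup.map f x (loopClasses γ ℓ i) =
      loopClasses (γ.map f.continuous) (fun i => (ℓ i).map f.continuous) i := by
  rw [loopClasses_apply, loopClasses_apply, map_conjPath]
  rfl

theorem map_nielsenClass (f : M ≃ₜ N) (H : Set M) (x : M) :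
    (fun (a : Fin k → FundamentalGroup M x) i =>
        FundamentalGroup.map (⟨f, f.continuous⟩ : C(M, N)) x (a i)) '' nielsenClass k H x =
      nielsenClass k (f '' H) (f x) := by
  apply Subset.antisymm
  · rintro _ ⟨b, ⟨v, ℓ, γ, hℓ, hb⟩, rfl⟩
    refine ⟨f v, _, γ.map f.continuous, hℓ.image f.isEmbedding, ?_⟩
    have h := hb.map (FundamentalGroup.map (⟨f, f.continuous⟩ : C(M, N)) x)
    rw [funext (map_loopClasses (⟨f, f.continuous⟩ : C(M, N)) γ ℓ)] at h
    exact h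
  · rintro b ⟨v', ℓ', γ', hℓ', hb⟩
    obtain ⟨v, rfl⟩ := f.surjective v'
    have hx : ∀ x, x = f.symm (f x) := fun x => (f.symm_apply_apply x).symm
    have hℓ := (hℓ'.image f.symm.isEmbedding).cast (hx v)
    rw [← image_comp, f.symm_comp_self, image_id] at hℓ
    let γ : Path x v := (γ'.map f.symm.continuous).cast (hx x) (hx v)
    have hloop : loopClasses γ' ℓ' = fun i =>
        FundamentalGroup.map (⟨f, f.continuous⟩ : C(M, N)) x (loopClasses γ
          (fun i => ((ℓ' i).map f.symm.continuous).cast (hx v) (hx v)) i) := by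
      funext i
      rw [map_loopClasses]
      congr 1
      · exact Path.ext (funext fun t => (f.apply_symm_apply _).symm)
      · funext i
        exact Path.ext (funext fun t => (f.apply_symm_apply _).symm)
    rw [hloop] at hb
    obtain ⟨b', hb', rfl⟩ := hb.exists_of_map
    exact ⟨b', ⟨v, _, γ, hℓ, hb'⟩, rfl⟩

theorem conjPath_map_of_homotopy {f : C(M, M)} (F : (ContinuousMap.id M).Homotopy f) (x : M)
    (a : FundamentalGroup M x) :
    conjPath (F.evalAt x) (FundamentalGroup.map f x a) = a := by
  have := (FundamentalGroupoidFunctor.homotopicMapsNatIso F).naturality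
    (X := ⟨x⟩) (Y := ⟨x⟩) a
  rw [conjPath_apply, ← Path.Homotopic.Quotient.trans_assoc]
  have h2 : (Path.Homotopic.Quotient.mk (F.evalAt x)).trans
      (FundamentalGroup.map f x a) =
      Path.Homotopic.Quotient.trans (Path.Homotopic.Quotient.map a (ContinuousMap.id M))
        (Path.Homotopic.Quotient.mk (F.evalAt x)) := this.symm
  rw [h2, Path.Homotopic.Quotient.trans_assoc, Path.Homotopic.Quotient.trans_symm,
    Path.Homotopic.Quotient.trans_refl]
  obtain ⟨p, rfl⟩ := Path.Homotopic.Quotient.mk_surjective a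
  rfl

theorem nielsenClass_of_homotopy (f : M ≃ₜ M)
    (F : (ContinuousMap.id M).Homotopy ⟨f, f.continuous⟩) (H : Set M) (x : M) :
    nielsenClass k (f '' H) x = nielsenClass k H x := by
  let β : Path x (f x) := F.evalAt x
  rw [← nielsenClass_conjPath (f '' H) β]
  rw [← map_nielsenClass, image_image]
  conv_rhs => rw [← image_id (nielsenClass k H x)]
  refine image_congr fun a _ => funext fun j => ?_
  exact conjPath_map_of_homotopy F x (a j)

/-! ### The Nielsen class of a subset with a spine -/

theorem loopsIn_eq_top_of_joinedIn {H : Set M} {x y : M} (hx : x ∈ H) (hy : y ∈ H)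
    (h : JoinedIn H x y) (htop : loopsIn H hx = ⊤) : loopsIn H hy = ⊤ := by
  obtain ⟨δ, hδ⟩ := h
  have hδ' : range δ ⊆ H := by rintro _ ⟨t, rfl⟩; exact hδ t
  rw [eq_top_iff]
  rintro a -
  obtain ⟨q, hq, hqa⟩ : conjPath δ a ∈ loopsIn H hx := htop ▸ Subgroup.mem_top _
  refine ⟨δ.symm.trans (q.trans δ), ?_, ?_⟩
  · rw [Path.trans_range, Path.trans_range, Path.symm_range]
    exact union_subset hδ' (union_subset hq hδ')
  · rw [Path.Homotopic.Quotient.mk_trans, Path.Homotopic.Quotient.mk_trans, hqa, conjPath_apply]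
    simp only [Path.Homotopic.Quotient.mk_symm, Path.Homotopic.Quotient.trans_assoc,
      Path.Homotopic.Quotient.symm_trans, Path.Homotopic.Quotient.trans_refl,
      quotient_symm_trans_cancel]

theorem isNielsenClass_nielsenClass [T2Space M] {H : Set M}
    (hH : SemilocallySimplyConnected H) {v : M} {ℓ : Fin k → Path v v} (hℓ : IsSpine H ℓ)
    {p : M} (hp : p ∈ H) (htop : loopsIn H hp = ⊤) {x₀ : M} (γ : Path x₀ v) :
    IsNielsenClass (nielsenClass k H x₀) := by
  let ι : C(H, M) := ⟨Subtype.val, continuous_subtype_val⟩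
  obtain ⟨hv, ℓ', hℓ'ℓ, hℓ'⟩ := hℓ.exists_subtype
  have := hℓ'.pathConnectedSpace
  let Ψ : FundamentalGroup H ⟨v, hv⟩ →* FundamentalGroup M x₀ :=
    (conjPath γ).toMonoidHom.comp (FundamentalGroup.map ι ⟨v, hv⟩)
  have hΨ : Function.Surjective Ψ := by
    refine (conjPath γ).surjective.comp fun a => ?_
    obtain ⟨q, hq, rfl⟩ : a ∈ loopsIn H hv := by
      rw [loopsIn_eq_top_of_joinedIn hp hv (hℓ.joinedIn hp hv) htop]; trivial
    exact ⟨Path.Homotopic.Quotient.mk (pathToSubtype q hq), rfl⟩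
  have hΨtop : ∀ a : Fin k → FundamentalGroup H ⟨v, hv⟩, Function.Bijective (FreeGroup.lift a) →
      Subgroup.closure (range fun i => Ψ (a i)) = ⊤ := by
    intro a ha
    have : range (fun i => Ψ (a i)) = Ψ '' range a := by rw [← range_comp]; rfl
    rw [this, ← MonoidHom.map_closure, ← FreeGroup.range_lift_eq_closure,
      MonoidHom.range_eq_top.2 ha.2, ← MonoidHom.range_eq_map, MonoidHom.range_eq_top]
    exact hΨ
  have hbij := hℓ'.lift_bijective hH
  have hloop : loopClasses γ ℓ = fun i => Ψ (edgeClass ℓ' i) := by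
    funext i
    rw [loopClasses_apply, edgeClass, ← hℓ'ℓ]
    rfl
  refine ⟨loopClasses γ ℓ, hloop ▸ hΨtop _ hbij, Subset.antisymm ?_ fun b hb => ⟨v, ℓ, γ, hℓ, hb⟩⟩
  rintro b ⟨v₂, ℓ₂, γ₂, hℓ₂, hb⟩
  refine NielsenEquiv.trans ?_ hb
  obtain ⟨hv₂, ℓ₂', hℓ₂'ℓ₂, hℓ₂'⟩ := hℓ₂.exists_subtype
  let δ : Path (⟨v, hv⟩ : H) ⟨v₂, hv₂⟩ := PathConnectedSpace.somePath _ _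
  have hbij₂ : Function.Bijective (FreeGroup.lift fun i => conjPath δ (edgeClass ℓ₂' i)) := by
    have : (FreeGroup.lift fun i => conjPath δ (edgeClass ℓ₂' i)) =
        (conjPath δ).toMonoidHom.comp (FreeGroup.lift (edgeClass ℓ₂')) := by
      ext i; simp
    rw [this]
    exact (conjPath δ).bijective.comp (hℓ₂'.lift_bijective hH)
  have h1 := (nielsenEquiv_of_bijective hbij hbij₂).map Ψ
  rw [hloop]
  refine h1.trans ?_
  let ε : Path x₀ x₀ := γ₂.trans (γ.trans (δ.map continuous_subtype_val)).symm
  let e : FundamentalGroup M x₀ := Path.Homotopic.Quotient.mk ε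
  have h2 := nielsenEquiv_conj (hΨtop _ hbij₂) e⁻¹
  convert h2 using 2 with i
  rw [inv_inv]
  have h3 : Ψ (conjPath δ (edgeClass ℓ₂' i)) =
      conjPath (γ.trans (δ.map continuous_subtype_val)) (edgeClass ℓ₂ i) := by
    rw [conjPath_trans]
    refine congrArg (conjPath γ) ((map_conjPath ι δ _).trans ?_)
    rw [edgeClass, edgeClass, ← hℓ₂'ℓ₂]
    rfl
  have h4 : ∀ a : FundamentalGroup M x₀, e⁻¹ * a * e = conjPath ε a := by
    intro a
    rw [conjPath_apply]
    rfl
  rw [h4, h3, ← conjPath_trans, loopClasses_apply, conjPath_apply, conjPath_apply]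
  simp only [ε, Path.Homotopic.Quotient.mk_trans, Path.Homotopic.Quotient.mk_symm,
    Path.Homotopic.Quotient.trans_assoc, quotient_trans_symm_rev, quotient_symm_symm,
    quotient_symm_trans_cancel]

end BasePoint

/-! ### Planar domains -/

section Planar

/-- The disc with `g` holes. -/
def planarRegion (g : ℕ) : Set ℂ := {z | ‖z‖ ≤ 5 ∧ 1 / 2 ≤ ‖z ^ g - 2‖}

theorem one_le_norm_pow_sub_two (g : ℕ) {z : ℂ} (hz : 5 ≤ ‖z‖) : 1 ≤ ‖z ^ g - 2‖ := by
  rcases Nat.eq_zero_or_pos g with rfl | hg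
  · norm_num
  · have h1 : (5 : ℝ) ≤ ‖z ^ g‖ := by
      rw [norm_pow]
      exact hz.trans (le_self_pow₀ (by linarith) hg.ne')
    have h2 := norm_sub_norm_le (z ^ g) 2
    rw [Complex.norm_ofNat] at h2
    linarith

theorem planarFun_nonneg_iff {g : ℕ} {z : ℂ} : 0 ≤ planarFun g z ↔ z ∈ planarRegion g := by
  have h0 := norm_nonneg z
  have h0' := norm_nonneg (z ^ g - 2)
  unfold planarFun
  constructor
  · intro h
    have h5 : ‖z‖ ≤ 5 := by
      by_contra! hlt
      have h1 := one_le_norm_pow_sub_two g hlt.le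
      have : (25 - ‖z‖ ^ 2) * (‖z ^ g - 2‖ ^ 2 - 1 / 4) < 0 :=
        mul_neg_of_neg_of_pos (by nlinarith) (by nlinarith)
      linarith
    refine ⟨h5, ?_⟩
    by_contra! hlt
    have h4 : ‖z‖ < 5 := by
      by_contra! h'
      linarith [one_le_norm_pow_sub_two g h']
    have : (25 - ‖z‖ ^ 2) * (‖z ^ g - 2‖ ^ 2 - 1 / 4) < 0 :=
      mul_neg_of_pos_of_neg (by nlinarith) (by nlinarith)
    linarith
  · rintro ⟨h1, h2⟩
    exact mul_nonneg (by nlinarith) (by nlinarith)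

theorem continuous_planarFun (g : ℕ) : Continuous (planarFun g) := by
  unfold planarFun; fun_prop

/-- The lift, under `z ↦ z ^ k`, of the homothety with centre `2` and ratio `c`. -/
noncomputable def rootPush (k : ℕ) (c : ℝ) (z : ℂ) : ℂ :=
  z * ((2 + c * (z ^ k - 2)) / z ^ k) ^ ((k : ℂ)⁻¹)

/-- The ratios `c` for which the homothety does not push `z ^ k` across the circle of radius `2`
with centre `2`. -/
def PushAdmissible (k : ℕ) (c : ℝ) (z : ℂ) : Prop :=
  0 < c ∧ (2 ≤ ‖z ^ k - 2‖ → 2 ≤ c * ‖z ^ k - 2‖) ∧ (‖z ^ k - 2‖ ≤ 2 → c * ‖z ^ k - 2‖ ≤ 2)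

variable {k : ℕ} {c : ℝ} {z : ℂ}

theorem rootPush_zero_left (c : ℝ) (z : ℂ) : rootPush 0 c z = z := by
  simp [rootPush]

theorem rootPush_one (k : ℕ) (z : ℂ) : rootPush k 1 z = z := by
  unfold rootPush
  by_cases hz : z = 0
  · simp [hz]
  · have : (2 + ((1 : ℝ) : ℂ) * (z ^ k - 2)) / z ^ k = 1 := by
      have := pow_ne_zero k hz
      field_simp
      push_cast
      ring
    rw [this, Complex.one_cpow, mul_one]

theorem PushAdmissible.eq_one_of_zero (hk : k ≠ 0) (h : PushAdmissible k c 0) : c = 1 := by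
  obtain ⟨-, h1, h2⟩ := h
  simp only [zero_pow hk, zero_sub, norm_neg, Complex.norm_ofNat, le_refl, forall_true_left]
    at h1 h2
  linarith

theorem rootPush_pow (hk : k ≠ 0) (h : PushAdmissible k c z) :
    rootPush k c z ^ k = 2 + c * (z ^ k - 2) := by
  unfold rootPush
  rw [mul_pow, Complex.cpow_nat_inv_pow _ hk]
  by_cases hz : z = 0
  · subst hz
    rw [h.eq_one_of_zero hk]
    simp [hk]
  · exact mul_div_cancel₀ _ (pow_ne_zero k hz)

theorem PushAdmissible.mem_slitPlane (h : PushAdmissible k c z) (hz : z ^ k ≠ 0)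
    (hH : 2 + c * (z ^ k - 2) ≠ 0) : (2 + c * (z ^ k - 2)) / z ^ k ∈ Complex.slitPlane := by
  rw [Complex.mem_slitPlane_iff]
  by_contra! hcon
  set w := z ^ k with hw
  set q := (2 + c * (w - 2)) / w with hq
  obtain ⟨hc, h1, h2⟩ := h
  rw [← hw] at h1 h2
  have hqw : q * w = 2 + c * (w - 2) := div_mul_cancel₀ _ hz
  have hqr : q = (q.re : ℂ) := Complex.ext rfl (by simpa using hcon.2)
  have hr : q.re < 0 := by
    refine lt_of_le_of_ne hcon.1 fun h0 => hH ?_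
    rw [← hqw, hqr, h0]; simp
  set r := q.re
  rw [hqr] at hqw
  have hwx : w = ((2 * (c - 1) / (c - r) : ℝ) : ℂ) := by
    have : ((c : ℂ) - r) ≠ 0 := by
      rw [← Complex.ofReal_sub]
      exact Complex.ofReal_ne_zero.2 (by linarith)
    push_cast
    field_simp
    linear_combination -hqw
  set x : ℝ := 2 * (c - 1) / (c - r)
  have hx0 : x ≠ 0 := by
    intro h0; rw [h0] at hwx; exact hz (by simpa using hwx)
  have hxr : r * x = 2 + c * (x - 2) := by
    rw [hwx] at hqw
    exact_mod_cast hqw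
  have hnorm : ‖w - 2‖ = |x - 2| := by
    rw [hwx, ← Real.norm_eq_abs, ← Complex.norm_real]
    push_cast
    rfl
  rw [hnorm] at h1 h2
  rcases lt_or_gt_of_ne hx0 with hx | hx
  · rw [abs_of_neg (by linarith)] at h1
    nlinarith [h1 (by linarith)]
  · rcases le_total x 2 with hx2 | hx2
    · rw [abs_of_nonpos (by linarith)] at h2
      nlinarith [h2 (by linarith)]
    · nlinarith

theorem continuousOn_rootPush (k : ℕ) :
    ContinuousOn (fun p : ℝ × ℂ => rootPush k p.1 p.2) {p | PushAdmissible k p.1 p.2} := by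
  rcases eq_or_ne k 0 with rfl | hk
  · simp only [rootPush_zero_left]
    exact continuousOn_snd
  rintro ⟨c, z⟩ (h : PushAdmissible k c z)
  have hH : Continuous fun p : ℝ × ℂ => 2 + (p.1 : ℂ) * (p.2 ^ k - 2) := by fun_prop
  by_cases hH0 : 2 + (c : ℂ) * (z ^ k - 2) = 0
  · have hroot : rootPush k c z = 0 := by
      have := rootPush_pow hk h
      rw [hH0] at this
      exact pow_eq_zero_iff hk |>.1 this
    show Filter.Tendsto _ _ (𝓝 (rootPush k c z))
    rw [hroot, tendsto_zero_iff_norm_tendsto_zero]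
    have hlim : Filter.Tendsto
        (fun p : ℝ × ℂ => ‖2 + (p.1 : ℂ) * (p.2 ^ k - 2)‖ ^ ((k : ℝ)⁻¹)) (𝓝 (c, z)) (𝓝 0) := by
      have hcont : Continuous
          fun p : ℝ × ℂ => ‖2 + (p.1 : ℂ) * (p.2 ^ k - 2)‖ ^ ((k : ℝ)⁻¹) :=
        hH.norm.rpow_const fun _ => Or.inr (by positivity)
      have := hcont.tendsto (c, z)
      simp only [hH0, norm_zero] at this
      rwa [Real.zero_rpow (by positivity)] at this
    refine (hlim.mono_left nhdsWithin_le_nhds).congr' ?_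
    filter_upwards [self_mem_nhdsWithin] with p hp
    rw [← rootPush_pow hk hp, norm_pow, Real.pow_rpow_inv_natCast (norm_nonneg _) hk]
  · have hz : z ≠ 0 := by
      rintro rfl
      rw [h.eq_one_of_zero hk] at hH0
      simp [hk] at hH0
    have hzk := pow_ne_zero k hz
    refine ContinuousAt.continuousWithinAt ?_
    unfold rootPush
    exact continuousAt_snd.mul ((hH.continuousAt.div (by fun_prop) hzk).cpow continuousAt_const
      (h.mem_slitPlane hzk hH0))

end Planar

section Clamp

variable {V : Type*} [NormedAddCommGroup V] [NormedSpace ℝ V]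

/-- The radial retraction onto the ball of radius `R`. -/
noncomputable def clampBall (R : ℝ) (v : V) : V := (R / max R ‖v‖) • v

theorem clampBall_of_norm_le {R : ℝ} {v : V} (h : ‖v‖ ≤ R) : clampBall R v = v := by
  unfold clampBall
  rw [max_eq_left h]
  rcases eq_or_ne R 0 with rfl | hR
  · simp [norm_le_zero_iff.1 h]
  · rw [div_self hR, one_smul]

theorem norm_clampBall_of_le {R : ℝ} {v : V} (hR : 0 ≤ R) (h : R ≤ ‖v‖) : ‖clampBall R v‖ = R := by
  unfold clampBall
  rw [max_eq_right h, norm_smul, Real.norm_of_nonneg (by positivity)]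
  rcases eq_or_ne ‖v‖ 0 with hv | hv
  · rw [hv] at h ⊢; simp; linarith
  · exact div_mul_cancel₀ _ hv

theorem norm_clampBall_le {R : ℝ} {v : V} (hR : 0 ≤ R) : ‖clampBall R v‖ ≤ R := by
  rcases le_total R ‖v‖ with h | h
  · exact (norm_clampBall_of_le hR h).le
  · rwa [clampBall_of_norm_le h]

theorem norm_clampBall_le_norm {R : ℝ} {v : V} (hR : 0 ≤ R) : ‖clampBall R v‖ ≤ ‖v‖ := by
  rcases le_total R ‖v‖ with h | h
  · rwa [norm_clampBall_of_le hR h]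
  · rw [clampBall_of_norm_le h]

theorem continuousOn_clampBall :
    ContinuousOn (fun p : ℝ × V => clampBall p.1 p.2) {p | 0 ≤ p.1} := by
  rintro ⟨R, v⟩ (hR : 0 ≤ R)
  by_cases hv : max R ‖v‖ = 0
  · have hv0 : v = 0 := norm_le_zero_iff.1 (hv ▸ le_max_right R ‖v‖)
    subst hv0
    show Filter.Tendsto _ _ (𝓝 (clampBall R (0 : V)))
    rw [clampBall_of_norm_le (by simpa using hR), tendsto_zero_iff_norm_tendsto_zero]
    have hlim : Filter.Tendsto (fun p : ℝ × V => ‖p.2‖) (𝓝[{p | 0 ≤ p.1}] (R, 0)) (𝓝 0) := by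
      have : Continuous fun p : ℝ × V => ‖p.2‖ := by fun_prop
      simpa using (this.tendsto (R, 0)).mono_left nhdsWithin_le_nhds
    refine squeeze_zero' (Filter.Eventually.of_forall fun _ => norm_nonneg _) ?_ hlim
    filter_upwards [self_mem_nhdsWithin] with p hp
    exact norm_clampBall_le_norm hp
  · refine ContinuousAt.continuousWithinAt ?_
    unfold clampBall
    exact (continuousAt_fst.div (by fun_prop) hv).smul continuousAt_snd

end Clamp

section PlanarRetract

/-- A retraction of `{z | z ^ g ≠ 2}` onto the planar region. -/
noncomputable def planarRetract (g : ℕ) (z : ℂ) : ℂ :=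
  clampBall 5 (rootPush g (max 1 (1 / (2 * ‖z ^ g - 2‖))) z)

variable {g : ℕ} {z : ℂ}

theorem norm_pow_sub_two_pos (hz : z ^ g ≠ 2) : 0 < ‖z ^ g - 2‖ := norm_pos_iff.2 (sub_ne_zero.2 hz)

theorem pushAdmissible_max (hz : z ^ g ≠ 2) :
    PushAdmissible g (max 1 (1 / (2 * ‖z ^ g - 2‖))) z := by
  have hd := norm_pow_sub_two_pos hz
  refine ⟨by positivity, fun h => ?_, fun h => ?_⟩
  · exact h.trans (le_mul_of_one_le_left hd.le (le_max_left _ _))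
  · rw [max_mul_of_nonneg _ _ hd.le]
    refine max_le (by linarith) ?_
    rw [div_mul_eq_mul_div, div_le_iff₀ (by positivity)]
    linarith

theorem continuousOn_planarRetract : ContinuousOn (planarRetract g) {z | z ^ g ≠ 2} := by
  have h0 : ContinuousOn (fun z : ℂ => 1 / (2 * ‖z ^ g - 2‖)) {z | z ^ g ≠ 2} := by
    refine ContinuousOn.div continuousOn_const (by fun_prop) fun z hz => ?_
    have := norm_pow_sub_two_pos hz
    positivity
  have h1 : ContinuousOn (fun z : ℂ => (max 1 (1 / (2 * ‖z ^ g - 2‖)), z)) {z | z ^ g ≠ 2} :=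
    ((continuous_const.max continuous_id).comp_continuousOn h0).prodMk continuousOn_id
  have h2 : ContinuousOn (fun z : ℂ => ((5 : ℝ), rootPush g (max 1 (1 / (2 * ‖z ^ g - 2‖))) z))
      {z | z ^ g ≠ 2} :=
    continuousOn_const.prodMk (ContinuousOn.comp (g := fun p : ℝ × ℂ => rootPush g p.1 p.2)
      (continuousOn_rootPush g) h1 fun z hz => pushAdmissible_max hz)
  exact ContinuousOn.comp (g := fun p : ℝ × ℂ => clampBall p.1 p.2)
    (f := fun z : ℂ => ((5 : ℝ), rootPush g (max 1 (1 / (2 * ‖z ^ g - 2‖))) z))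
    continuousOn_clampBall h2 fun z _ => show (0 : ℝ) ≤ 5 by norm_num

theorem planarRetract_mem (hz : z ^ g ≠ 2) : planarRetract g z ∈ planarRegion g := by
  have hd := norm_pow_sub_two_pos hz
  set z' := rootPush g (max 1 (1 / (2 * ‖z ^ g - 2‖))) z with hz'
  have h1 : 1 / 2 ≤ ‖z' ^ g - 2‖ := by
    rcases eq_or_ne g 0 with rfl | hg
    · norm_num
    · rw [hz', rootPush_pow hg (pushAdmissible_max hz), add_sub_cancel_left, norm_mul,
        Complex.norm_real, Real.norm_of_nonneg (by positivity)]
      refine le_trans ?_ (mul_le_mul_of_nonneg_right (le_max_right _ _) hd.le)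
      rw [div_mul_eq_mul_div, div_le_div_iff₀ (by norm_num) (by positivity)]
      linarith
  refine ⟨norm_clampBall_le (by norm_num), ?_⟩
  show 1 / 2 ≤ ‖clampBall 5 z' ^ g - 2‖
  rcases le_total ‖z'‖ 5 with h | h
  · rwa [clampBall_of_norm_le h]
  · linarith [one_le_norm_pow_sub_two g (norm_clampBall_of_le (by norm_num) h).ge]

theorem planarRetract_of_mem (hz : z ∈ planarRegion g) : planarRetract g z = z := by
  have : max 1 (1 / (2 * ‖z ^ g - 2‖)) = 1 := by
    refine max_eq_left ?_
    rw [div_le_one (by linarith [hz.2])]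
    linarith [hz.2]
  rw [planarRetract, this, rootPush_one, clampBall_of_norm_le hz.1]

theorem pow_ne_two_of_mem (hz : z ∈ planarRegion g) : z ^ g ≠ 2 := by
  intro h
  have := hz.2
  rw [h] at this
  norm_num at this

end PlanarRetract

/-! ### Local topology of handlebodies -/

section Handlebody

variable {V : Type*} [NormedAddCommGroup V] {g : ℕ}

theorem mem_handlebody {p : ℂ × V} :
    p ∈ handlebody V g ↔ p.1 ∈ planarRegion g ∧ ‖p.2‖ ≤ √(planarFun g p.1) := by
  constructor
  · intro h
    have h' : ‖p.2‖ ^ 2 ≤ planarFun g p.1 := h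
    exact ⟨planarFun_nonneg_iff.1 ((sq_nonneg _).trans h'), Real.le_sqrt_of_sq_le h'⟩
  · rintro ⟨h1, h2⟩
    exact (Real.le_sqrt (norm_nonneg _) (planarFun_nonneg_iff.2 h1)).1 h2

theorem mem_handlebodyBoundary {p : ℂ × V} :
    p ∈ handlebodyBoundary V g ↔ p.1 ∈ planarRegion g ∧ ‖p.2‖ = √(planarFun g p.1) := by
  constructor
  · intro h
    have h' : ‖p.2‖ ^ 2 = planarFun g p.1 := h
    refine ⟨planarFun_nonneg_iff.1 (h' ▸ sq_nonneg _), ?_⟩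
    rw [← h', Real.sqrt_sq (norm_nonneg _)]
  · rintro ⟨h1, h2⟩
    show ‖p.2‖ ^ 2 = _
    rw [h2, Real.sq_sqrt (planarFun_nonneg_iff.2 h1)]

theorem handlebodyBoundary_subset : handlebodyBoundary V g ⊆ handlebody V g := fun _ h => le_of_eq h

theorem isCompact_handlebody [ProperSpace V] : IsCompact (handlebody V g) := by
  have hcl : IsClosed (handlebody V g) :=
    isClosed_le (by fun_prop) ((continuous_planarFun g).comp continuous_fst)
  have hR : IsCompact (planarRegion g) := by
    refine (isCompact_closedBall (0 : ℂ) 5).of_isClosed_subset ?_ fun z hz => by simpa using hz.1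
    have h1 : IsClosed {z : ℂ | ‖z‖ ≤ 5} := isClosed_le (by fun_prop) (by fun_prop)
    have h2 : IsClosed {z : ℂ | 1 / 2 ≤ ‖z ^ g - 2‖} := isClosed_le (by fun_prop) (by fun_prop)
    exact h1.inter h2
  obtain ⟨C, hC⟩ := (hR.image (continuous_planarFun g).sqrt).bddAbove
  refine (hR.prod (isCompact_closedBall (0 : V) C)).of_isClosed_subset hcl fun p hp => ?_
  rw [mem_handlebody] at hp
  exact ⟨hp.1, by simpa using hp.2.trans (hC ⟨_, hp.1, rfl⟩)⟩

variable [NormedSpace ℝ V]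

theorem exists_retraction_handlebody (V : Type*) [NormedAddCommGroup V] [NormedSpace ℝ V] (g : ℕ) :
    ∃ (O : Set (ℂ × V)) (r : ℂ × V → ℂ × V), IsOpen O ∧ handlebody V g ⊆ O ∧ ContinuousOn r O ∧
      MapsTo r O (handlebody V g) ∧ ∀ x ∈ handlebody V g, r x = x := by
  refine ⟨{p | p.1 ^ g ≠ 2}, fun p => (planarRetract g p.1,
    clampBall (√(planarFun g (planarRetract g p.1))) p.2), ?_, ?_, ?_, ?_, ?_⟩
  · exact isOpen_ne_fun (by fun_prop) continuous_const
  · exact fun p hp => pow_ne_two_of_mem (mem_handlebody.1 hp).1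
  · have h1 : ContinuousOn (fun p : ℂ × V => planarRetract g p.1) {p | p.1 ^ g ≠ 2} :=
      continuousOn_planarRetract.comp continuousOn_fst fun p hp => hp
    have h2 := ((continuous_planarFun g).sqrt.comp_continuousOn h1).prodMk
      (continuousOn_snd (s := {p : ℂ × V | p.1 ^ g ≠ 2}))
    exact h1.prodMk (continuousOn_clampBall.comp h2 fun p _ => Real.sqrt_nonneg _)
  · exact fun p hp => mem_handlebody.2 ⟨planarRetract_mem hp,
      norm_clampBall_le (Real.sqrt_nonneg _)⟩
  · intro p hp
    rw [mem_handlebody] at hp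
    simp only [planarRetract_of_mem hp.1]
    rw [clampBall_of_norm_le hp.2]

theorem semilocallySimplyConnected_handlebody :
    SemilocallySimplyConnected (handlebody V g) := by
  obtain ⟨O, r, hO, hKO, hr, hrK, hfix⟩ := exists_retraction_handlebody V g
  exact semilocallySimplyConnected_of_retract hO hKO hr hrK hfix

instance : LocallyPathConnectedSpace (handlebody V g) := by
  obtain ⟨O, r, hO, hKO, hr, hrK, hfix⟩ := exists_retraction_handlebody V g
  exact locallyPathConnectedSpace_of_retract hO hKO hr hrK hfix

end Handlebody

/-! ### Spines of handlebodies -/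

section Petals

variable {k : ℕ}

theorem norm_zero_pow_sub_two (hk : k ≠ 0) : ‖(0 : ℂ) ^ k - 2‖ = 2 := by
  rw [zero_pow hk]; norm_num

/-- The parametrization of the circle with centre `2` and radius `2` that starts at `0`. -/
noncomputable def circleParam (s : ℝ) : ℂ := 2 - 2 * Complex.exp (2 * Real.pi * s * Complex.I)

theorem norm_circleParam_sub_two (s : ℝ) : ‖circleParam s - 2‖ = 2 := by
  have h : circleParam s - 2 = -(2 * Complex.exp ((2 * Real.pi * s : ℝ) * Complex.I)) := by
    unfold circleParam; push_cast; ring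
  rw [h, norm_neg, norm_mul, Complex.norm_exp_ofReal_mul_I]
  norm_num

theorem circleParam_zero : circleParam 0 = 0 := by simp [circleParam]

theorem circleParam_one : circleParam 1 = 0 := by
  simp [circleParam, Complex.exp_two_pi_mul_I]

theorem circleParam_eq_iff {s t : ℝ} : circleParam s = circleParam t ↔ ∃ n : ℤ, s = t + n := by
  have hpi : (2 * Real.pi * Complex.I : ℂ) ≠ 0 := Complex.two_pi_I_ne_zero
  have : circleParam s = circleParam t ↔
      Complex.exp (2 * Real.pi * s * Complex.I) = Complex.exp (2 * Real.pi * t * Complex.I) := by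
    unfold circleParam
    constructor
    · intro h; linear_combination (-1 / 2) * h
    · intro h; rw [h]
  rw [this, Complex.exp_eq_exp_iff_exists_int]
  refine exists_congr fun n => ⟨fun h => ?_, fun h => ?_⟩
  · have h2 : (2 * Real.pi * Complex.I : ℂ) * s = (2 * Real.pi * Complex.I) * (t + n) := by
      linear_combination h
    exact_mod_cast mul_left_cancel₀ hpi h2
  · rw [h]; push_cast; ring

theorem eq_or_of_circleParam_eq {s t : I} (h : circleParam s = circleParam t) :
    s = t ∨ ((s = 0 ∨ s = 1) ∧ (t = 0 ∨ t = 1)) := by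
  obtain ⟨n, hn⟩ := circleParam_eq_iff.1 h
  have hs0 := s.2.1
  have hs1 := s.2.2
  have ht0 := t.2.1
  have ht1 := t.2.2
  have h1 : n ≤ 1 := by
    have : (n : ℝ) ≤ 1 := by linarith
    exact_mod_cast this
  have h2 : -1 ≤ n := by
    have : (-1 : ℝ) ≤ n := by linarith
    exact_mod_cast this
  have hcase : n = -1 ∨ n = 0 ∨ n = 1 := by omega
  rcases hcase with rfl | rfl | rfl
  · push_cast at hn
    exact Or.inr ⟨Or.inl (Subtype.ext (show (s : ℝ) = 0 by linarith)),
      Or.inr (Subtype.ext (show (t : ℝ) = 1 by linarith))⟩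
  · exact Or.inl (Subtype.ext (by simpa using hn))
  · push_cast at hn
    exact Or.inr ⟨Or.inr (Subtype.ext (show (s : ℝ) = 1 by linarith)),
      Or.inl (Subtype.ext (show (t : ℝ) = 0 by linarith))⟩

theorem exists_circleParam_eq {w : ℂ} (hw : ‖w - 2‖ = 2) : ∃ s : I, circleParam s = w := by
  have h1 : ‖(2 - w) / 2‖ = 1 := by
    rw [norm_div, ← norm_neg, neg_sub, hw]; norm_num
  obtain ⟨θ, hθ⟩ := (Complex.norm_eq_one_iff _).1 h1
  refine ⟨⟨Int.fract (θ / (2 * Real.pi)), Int.fract_nonneg _, (Int.fract_lt_one _).le⟩, ?_⟩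
  have h2 : circleParam (Int.fract (θ / (2 * Real.pi))) = circleParam (θ / (2 * Real.pi)) :=
    circleParam_eq_iff.2 ⟨-⌊θ / (2 * Real.pi)⌋, by
      rw [Int.fract]; push_cast; ring⟩
  have h3 : (2 * Real.pi * ((θ / (2 * Real.pi) : ℝ) : ℂ) * Complex.I) = θ * Complex.I := by
    have : (Real.pi : ℂ) ≠ 0 := Complex.ofReal_ne_zero.2 Real.pi_ne_zero
    push_cast
    field_simp
  show circleParam (Int.fract (θ / (2 * Real.pi))) = w
  rw [h2, circleParam, h3, hθ]
  ring

theorem re_nonneg_of_norm_sub_two {w : ℂ} (hw : ‖w - 2‖ = 2) : 0 ≤ w.re := by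
  have := Complex.abs_re_le_norm (w - 2)
  rw [hw, abs_le] at this
  simp at this
  linarith

/-- The petals of the lemniscate `‖z ^ k - 2‖ = 2`. -/
noncomputable def petal (k j : ℕ) (s : ℝ) : ℂ :=
  Complex.exp (2 * Real.pi * Complex.I / k) ^ j * circleParam s ^ ((k : ℂ)⁻¹)

theorem petal_pow (hk : k ≠ 0) (j : ℕ) (s : ℝ) : petal k j s ^ k = circleParam s := by
  unfold petal
  rw [mul_pow, Complex.cpow_nat_inv_pow _ hk, ← pow_mul, mul_comm j, pow_mul,
    (Complex.isPrimitiveRoot_exp k hk).pow_eq_one, one_pow, one_mul]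

theorem petal_eq_zero_iff (hk : k ≠ 0) {j : ℕ} {s : ℝ} : petal k j s = 0 ↔ circleParam s = 0 := by
  rw [← petal_pow hk j s, pow_eq_zero_iff hk]

theorem continuous_petal (hk : k ≠ 0) (j : ℕ) : Continuous (petal k j) := by
  have hc : Continuous circleParam := by unfold circleParam; fun_prop
  refine continuous_const.mul (continuous_iff_continuousAt.2 fun s => ?_)
  have h := Complex.continuousAt_cpow_const_of_re_pos (z := circleParam s) (w := (k : ℂ)⁻¹)
    (Or.inl (re_nonneg_of_norm_sub_two (norm_circleParam_sub_two s))) (by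
      rw [← Complex.ofReal_natCast, ← Complex.ofReal_inv, Complex.ofReal_re]
      positivity)
  exact ContinuousAt.comp (g := fun z : ℂ => z ^ ((k : ℂ)⁻¹)) h hc.continuousAt

theorem petal_embedded (hk : k ≠ 0) {i j : Fin k} {s t : I} (h : petal k i s = petal k j t) :
    (i = j ∧ s = t) ∨ ((s = 0 ∨ s = 1) ∧ (t = 0 ∨ t = 1)) := by
  have h1 : circleParam s = circleParam t := by
    rw [← petal_pow hk i, ← petal_pow hk j, h]
  rcases eq_or_of_circleParam_eq h1 with rfl | h2
  · by_cases h0 : circleParam s = 0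
    · have h0' : circleParam s = circleParam (0 : I) := by rw [h0]; exact circleParam_zero.symm
      rcases eq_or_of_circleParam_eq h0' with rfl | h2
      · simp
      · exact Or.inr ⟨h2.1, h2.1⟩
    · refine Or.inl ⟨?_, rfl⟩
      have h3 : circleParam s ^ ((k : ℂ)⁻¹) ≠ 0 := by
        rw [Ne, Complex.cpow_eq_zero_iff]; tauto
      have h4 := mul_right_cancel₀ h3 h
      exact Fin.ext ((Complex.isPrimitiveRoot_exp k hk).pow_inj i.2 j.2 h4)
  · exact Or.inr h2

theorem exists_petal_eq (hk : k ≠ 0) {z : ℂ} (hz : ‖z ^ k - 2‖ = 2) :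
    ∃ (j : Fin k) (s : I), petal k j s = z := by
  obtain ⟨s, hs⟩ := exists_circleParam_eq hz
  by_cases hz0 : z = 0
  · subst hz0
    refine ⟨⟨0, Nat.pos_of_ne_zero hk⟩, s, (petal_eq_zero_iff hk).2 ?_⟩
    rw [hs, zero_pow hk]
  · have hne : circleParam s ^ ((k : ℂ)⁻¹) ≠ 0 := by
      rw [Ne, Complex.cpow_eq_zero_iff, hs]
      exact fun h => pow_ne_zero k hz0 h.1
    have h1 : (z / circleParam s ^ ((k : ℂ)⁻¹)) ^ k = 1 := by
      rw [div_pow, Complex.cpow_nat_inv_pow _ hk, hs, div_self (pow_ne_zero k hz0)]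
    have : NeZero k := ⟨hk⟩
    obtain ⟨j, hj, hjz⟩ := (Complex.isPrimitiveRoot_exp k hk).eq_pow_of_pow_eq_one h1
    refine ⟨⟨j, hj⟩, s, ?_⟩
    unfold petal
    rw [hjz, div_mul_cancel₀ _ hne]

end Petals

section Deformation

variable {k : ℕ} {z : ℂ}

/-- The deformation of a planar domain onto the lemniscate `‖z ^ k - 2‖ = 2`. -/
noncomputable def planarDeform (k : ℕ) (t : ℝ) (z : ℂ) : ℂ :=
  rootPush k ((1 - t) + 2 * t / ‖z ^ k - 2‖) z

theorem deform_ratio_mul (t : ℝ) (hz : z ∈ planarRegion k) :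
    ((1 - t) + 2 * t / ‖z ^ k - 2‖) * ‖z ^ k - 2‖ = (1 - t) * ‖z ^ k - 2‖ + t * 2 := by
  have : ‖z ^ k - 2‖ ≠ 0 := by linarith [hz.2]
  field_simp

theorem pushAdmissible_deform {t : ℝ} (ht : t ∈ I) (hz : z ∈ planarRegion k) :
    PushAdmissible k ((1 - t) + 2 * t / ‖z ^ k - 2‖) z := by
  have hd : 0 < ‖z ^ k - 2‖ := by linarith [hz.2]
  have h1 : 0 ≤ 1 - t := by linarith [ht.2]
  have h0 : 0 ≤ t := ht.1
  refine ⟨?_, fun h => ?_, fun h => ?_⟩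
  · have : 0 < (1 - t) * ‖z ^ k - 2‖ + t * 2 := by
      rcases h0.eq_or_lt with rfl | h0
      · linarith
      · positivity
    rw [← deform_ratio_mul t hz] at this
    exact pos_of_mul_pos_left this hd.le
  · rw [deform_ratio_mul t hz]; nlinarith
  · rw [deform_ratio_mul t hz]; nlinarith

theorem norm_planarDeform_pow (hk : k ≠ 0) {t : ℝ} (ht : t ∈ I) (hz : z ∈ planarRegion k) :
    ‖planarDeform k t z ^ k - 2‖ = (1 - t) * ‖z ^ k - 2‖ + t * 2 := by
  have hadm := pushAdmissible_deform ht hz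
  rw [planarDeform, rootPush_pow hk hadm, add_sub_cancel_left, norm_mul, Complex.norm_real,
    Real.norm_of_nonneg hadm.1.le, deform_ratio_mul t hz]

theorem planarDeform_mem (hk : k ≠ 0) {t : ℝ} (ht : t ∈ I) (hz : z ∈ planarRegion k) :
    planarDeform k t z ∈ planarRegion k := by
  have hnorm := norm_planarDeform_pow hk ht hz
  have h1 : 0 ≤ 1 - t := by linarith [ht.2]
  have h0 : 0 ≤ t := ht.1
  have h5 : (5 : ℝ) ≤ 5 ^ k := le_self_pow₀ (by norm_num) hk
  refine ⟨?_, by rw [hnorm]; nlinarith [hz.2]⟩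
  rw [← pow_le_pow_iff_left₀ (norm_nonneg _) (by norm_num) hk, ← norm_pow]
  rcases le_total ‖z ^ k - 2‖ 2 with hd | hd
  · have h2 := norm_add_le (planarDeform k t z ^ k - 2) 2
    rw [sub_add_cancel, hnorm, Complex.norm_ofNat] at h2
    nlinarith
  · have hadm := pushAdmissible_deform ht hz
    set c := (1 - t) + 2 * t / ‖z ^ k - 2‖ with hc
    have hc1 : c ≤ 1 := by
      have : 2 * t / ‖z ^ k - 2‖ ≤ t := by
        rw [div_le_iff₀ (by linarith)]; nlinarith
      linarith
    have h2 : planarDeform k t z ^ k = ((1 - c : ℝ) : ℂ) * 2 + (c : ℂ) * z ^ k := by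
      rw [planarDeform, rootPush_pow hk hadm]; push_cast; ring
    have h3 : ‖z ^ k‖ ≤ 5 ^ k := by
      rw [norm_pow]; exact pow_le_pow_left₀ (norm_nonneg _) hz.1 k
    rw [h2]
    refine (norm_add_le _ _).trans ?_
    rw [norm_mul, norm_mul, Complex.norm_real, Complex.norm_real, Complex.norm_ofNat,
      Real.norm_of_nonneg (by linarith), Real.norm_of_nonneg hadm.1.le]
    nlinarith [hadm.1]

theorem planarDeform_zero (k : ℕ) (z : ℂ) : planarDeform k 0 z = z := by
  simp [planarDeform, rootPush_one]

theorem planarDeform_of_norm_eq (t : ℝ) (hz : ‖z ^ k - 2‖ = 2) : planarDeform k t z = z := by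
  rw [planarDeform, hz, show (1 - t) + 2 * t / 2 = 1 by ring, rootPush_one]

theorem continuousOn_planarDeform (k : ℕ) :
    ContinuousOn (fun p : ℝ × ℂ => planarDeform k p.1 p.2) (I ×ˢ planarRegion k) := by
  have h1 : ContinuousOn (fun p : ℝ × ℂ => ((1 - p.1) + 2 * p.1 / ‖p.2 ^ k - 2‖, p.2))
      (I ×ˢ planarRegion k) := by
    refine ContinuousOn.prodMk (ContinuousOn.add (by fun_prop)
      (ContinuousOn.div (by fun_prop) (by fun_prop) ?_)) continuousOn_snd
    rintro p ⟨-, hp⟩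
    linarith [hp.2]
  exact ContinuousOn.comp (g := fun p : ℝ × ℂ => rootPush k p.1 p.2) (continuousOn_rootPush k) h1
    fun p hp => pushAdmissible_deform hp.1 hp.2

end Deformation

section Spine

variable {V : Type*} [NormedAddCommGroup V]

theorem mem_handlebody_zero {k : ℕ} {z : ℂ} (hz : z ∈ planarRegion k) :
    (z, (0 : V)) ∈ handlebody V k :=
  mem_handlebody.2 ⟨hz, by simp⟩

variable [NormedSpace ℝ V]

theorem exists_spine_handlebody_zero : ∃ ℓ : Fin 0 → Path (0 : ℂ × V) 0,
    IsSpine (handlebody V 0) ℓ := by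
  have hrose : roseSet (fun i : Fin 0 => Fin.elim0 i : Fin 0 → Path (0 : ℂ × V) 0) = {0} := by
    simp [roseSet]
  have hmem : ∀ p : ℂ × V, p ∈ handlebody V 0 ↔ ‖p.2‖ ^ 2 ≤ (25 - ‖p.1‖ ^ 2) * (3 / 4) := by
    intro p
    have : ‖p.1 ^ 0 - 2‖ = 1 := by norm_num
    show _ ≤ planarFun 0 p.1 ↔ _
    rw [planarFun, this]
    norm_num
  refine ⟨fun i => Fin.elim0 i, ?_, fun i => Fin.elim0 i, ?_⟩
  · rw [hrose, singleton_subset_iff, hmem]; norm_num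
  · have hD : ∀ (t : I) (p : handlebody V 0), (1 - (t : ℝ)) • (p : ℂ × V) ∈ handlebody V 0 := by
      intro t p
      have hp := (hmem _).1 p.2
      have ht : 0 ≤ 1 - (t : ℝ) := by linarith [t.2.2]
      have ht1 : (1 - (t : ℝ)) ^ 2 ≤ 1 := by nlinarith [t.2.1]
      rw [hmem, Prod.smul_snd, Prod.smul_fst, norm_smul, norm_smul, Real.norm_of_nonneg ht,
        mul_pow, mul_pow]
      have h1 := sq_nonneg ‖(p : ℂ × V).1‖
      have h2 := sq_nonneg ‖(p : ℂ × V).2‖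
      nlinarith
    refine ⟨⟨fun x => ⟨(1 - (x.1 : ℝ)) • (x.2 : ℂ × V), hD x.1 x.2⟩, ?_⟩, fun x => ?_, fun x => ?_,
      fun t x hx => ?_⟩
    · exact Continuous.subtype_mk (by fun_prop) _
    · exact Subtype.ext (by simp)
    · rw [hrose]; simp
    · rw [hrose] at hx
      refine Subtype.ext ?_
      have hx0 : (x : ℂ × V) = 0 := hx
      simp [hx0]

theorem exists_spine_handlebody_of_ne_zero {k : ℕ} (hk : k ≠ 0) :
    ∃ ℓ : Fin k → Path (0 : ℂ × V) 0, IsSpine (handlebody V k) ℓ := by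
  let ℓ : Fin k → Path (0 : ℂ × V) 0 := fun j =>
    { toFun := fun s => (petal k j s, 0)
      continuous_toFun :=
        ((continuous_petal hk j).comp continuous_subtype_val).prodMk continuous_const
      source' := Prod.ext ((petal_eq_zero_iff hk).2 circleParam_zero) rfl
      target' := Prod.ext ((petal_eq_zero_iff hk).2 circleParam_one) rfl }
  have hrose : ∀ p : ℂ × V, p ∈ roseSet ℓ ↔ ‖p.1 ^ k - 2‖ = 2 ∧ p.2 = 0 := by
    intro p
    constructor
    · rintro (rfl | hp)
      · exact ⟨norm_zero_pow_sub_two hk, rfl⟩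
      · obtain ⟨j, s, rfl⟩ := mem_iUnion.1 hp
        refine ⟨?_, rfl⟩
        show ‖petal k j s ^ k - 2‖ = 2
        rw [petal_pow hk, norm_circleParam_sub_two]
    · rintro ⟨h1, h2⟩
      obtain ⟨j, s, hs⟩ := exists_petal_eq hk h1
      exact Or.inr (mem_iUnion.2 ⟨j, s, Prod.ext hs h2.symm⟩)
  have hreg : ∀ p ∈ roseSet ℓ, p ∈ handlebody V k := by
    intro p hp
    obtain ⟨h1, h2⟩ := (hrose p).1 hp
    have hz : p.1 ∈ planarRegion k := by
      refine ⟨?_, by rw [h1]; norm_num⟩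
      rw [← pow_le_pow_iff_left₀ (norm_nonneg _) (by norm_num) hk, ← norm_pow]
      have h3 := norm_add_le (p.1 ^ k - 2) 2
      rw [sub_add_cancel, h1, Complex.norm_ofNat] at h3
      have h5 : (5 : ℝ) ≤ 5 ^ k := le_self_pow₀ (by norm_num) hk
      linarith
    have := mem_handlebody_zero (V := V) hz
    rwa [← h2] at this
  refine ⟨ℓ, hreg, fun i j s t h => petal_embedded hk (congrArg Prod.fst h), ?_⟩
  have hI1 : ∀ t : I, max 0 (2 * (t : ℝ) - 1) ∈ I := fun t =>
    ⟨le_max_left _ _, max_le (by norm_num) (by linarith [t.2.2])⟩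
  let D : I × handlebody V k → ℂ × V := fun x =>
    (planarDeform k (max 0 (2 * (x.1 : ℝ) - 1)) (x.2 : ℂ × V).1,
      max 0 (1 - 2 * (x.1 : ℝ)) • (x.2 : ℂ × V).2)
  have hDmem : ∀ x, D x ∈ handlebody V k := by
    rintro ⟨t, p⟩
    have hp := mem_handlebody.1 p.2
    rcases le_total (2 * (t : ℝ)) 1 with ht | ht
    · have h1 : max 0 (2 * (t : ℝ) - 1) = 0 := max_eq_left (by linarith)
      have h2 : max 0 (1 - 2 * (t : ℝ)) = 1 - 2 * t := max_eq_right (by linarith)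
      simp only [D, h1, h2, planarDeform_zero]
      refine mem_handlebody.2 ⟨hp.1, le_trans ?_ hp.2⟩
      rw [norm_smul, Real.norm_of_nonneg (by linarith)]
      exact mul_le_of_le_one_left (norm_nonneg _) (by linarith [t.2.1])
    · have h2 : max 0 (1 - 2 * (t : ℝ)) = 0 := max_eq_left (by linarith)
      simp only [D, h2, zero_smul]
      exact mem_handlebody_zero (planarDeform_mem hk (hI1 t) hp.1)
  have hDcont : Continuous D := by
    refine Continuous.prodMk ?_ (by fun_prop)
    exact (continuousOn_planarDeform k).comp_continuous
      (f := fun x : I × handlebody V k => (max 0 (2 * (x.1 : ℝ) - 1), (x.2 : ℂ × V).1))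
      (by fun_prop) fun x => ⟨hI1 x.1, (mem_handlebody.1 x.2.2).1⟩
  refine ⟨⟨fun x => ⟨D x, hDmem x⟩, hDcont.subtype_mk _⟩, fun x => ?_, fun x => ?_,
    fun t x hx => ?_⟩
  · refine Subtype.ext ?_
    show D (0, x) = x
    simp [D, planarDeform_zero]
  · show D (1, x) ∈ _
    rw [hrose]
    have h1 : max 0 (2 * ((1 : I) : ℝ) - 1) = 1 := by norm_num
    have h2 : max 0 (1 - 2 * ((1 : I) : ℝ)) = 0 := by norm_num
    simp only [D, h1, h2, zero_smul]
    refine ⟨?_, trivial⟩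
    rw [norm_planarDeform_pow hk (by simp) (mem_handlebody.1 x.2).1]
    ring
  · refine Subtype.ext ?_
    obtain ⟨h1, h2⟩ := (hrose _).1 hx
    show D (t, x) = x
    simp only [D, planarDeform_of_norm_eq _ h1, h2, smul_zero]
    exact Prod.ext rfl h2.symm

theorem exists_spine_handlebody (V : Type*) [NormedAddCommGroup V] [NormedSpace ℝ V] (k : ℕ) :
    ∃ ℓ : Fin k → Path (0 : ℂ × V) 0, IsSpine (handlebody V k) ℓ := by
  rcases eq_or_ne k 0 with rfl | hk
  · exact exists_spine_handlebody_zero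
  · exact exists_spine_handlebody_of_ne_zero hk

end Spine

/-! ### The boundary of a handlebody -/

section Boundary

variable {V : Type*} [NormedAddCommGroup V] [NormedSpace ℝ V] {g : ℕ}

theorem exists_unit_smul_eq [Nontrivial V] (v : V) : ∃ e : V, ‖e‖ = 1 ∧ v = ‖v‖ • e := by
  by_cases hv : v = 0
  · obtain ⟨e, he⟩ := exists_norm_eq V (zero_le_one : (0 : ℝ) ≤ 1)
    exact ⟨e, he, by simp [hv]⟩
  · have h := norm_ne_zero_iff.2 hv
    refine ⟨‖v‖⁻¹ • v, ?_, ?_⟩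
    · rw [norm_smul, norm_inv, norm_norm, inv_mul_cancel₀ h]
    · rw [smul_smul, mul_inv_cancel₀ h, one_smul]

theorem sqrt_smul_mem_handlebodyBoundary {z : ℂ} (hz : z ∈ planarRegion g) {e : V} (he : ‖e‖ = 1) :
    (z, √(planarFun g z) • e) ∈ handlebodyBoundary V g := by
  refine mem_handlebodyBoundary.2 ⟨hz, ?_⟩
  rw [norm_smul, he, mul_one, Real.norm_of_nonneg (Real.sqrt_nonneg _)]

theorem planarFun_five (g : ℕ) : planarFun g 5 = 0 := by
  norm_num [planarFun]

theorem handlebodyBoundary_nonempty (V : Type*) [NormedAddCommGroup V] (g : ℕ) :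
    ((5 : ℂ), (0 : V)) ∈ handlebodyBoundary V g := by
  show ‖(0 : V)‖ ^ 2 = planarFun g 5
  rw [planarFun_five]; simp

theorem joinedIn_handlebody {x y : ℂ × V} (hx : x ∈ handlebody V g) (hy : y ∈ handlebody V g) :
    JoinedIn (handlebody V g) x y := by
  obtain ⟨ℓ, hℓ⟩ := exists_spine_handlebody V g
  exact hℓ.joinedIn hx hy

theorem joinedIn_handlebodyBoundary [Nontrivial V] {x y : ℂ × V} (hx : x ∈ handlebodyBoundary V g)
    (hy : y ∈ handlebodyBoundary V g) : JoinedIn (handlebodyBoundary V g) x y := by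
  have key : ∀ x ∈ handlebodyBoundary V g, JoinedIn (handlebodyBoundary V g) x (5, 0) := by
    intro x hx
    obtain ⟨e, he, hxe⟩ := exists_unit_smul_eq x.2
    obtain ⟨p, hp⟩ := joinedIn_handlebody (handlebodyBoundary_subset hx)
      (handlebodyBoundary_subset (handlebodyBoundary_nonempty V g))
    have hpc : Continuous fun t => (p t).1 := by fun_prop
    refine ⟨⟨⟨fun t => ((p t).1, √(planarFun g (p t).1) • e), ?_⟩, ?_, ?_⟩, fun t => ?_⟩
    · exact hpc.prodMk ((((continuous_planarFun g).comp hpc).sqrt).smul continuous_const)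
    · simp only [Path.source]
      refine Prod.ext rfl ?_
      show _ • e = x.2
      rw [← (mem_handlebodyBoundary.1 hx).2, ← hxe]
    · simp [planarFun_five]
    · exact sqrt_smul_mem_handlebodyBoundary (mem_handlebody.1 (hp t)).1 he
  exact (key x hx).trans (key y hy).symm

theorem loopsIn_handlebodyBoundary [Nontrivial V] (x : handlebody V g)
    (hx : (x : ℂ × V) ∈ handlebodyBoundary V g) :
    loopsIn (Subtype.val ⁻¹' handlebodyBoundary V g : Set (handlebody V g)) hx = ⊤ := by
  rw [eq_top_iff]
  rintro a -
  obtain ⟨q, rfl⟩ := Path.Homotopic.Quotient.mk_surjective a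
  obtain ⟨e, he, hxe⟩ := exists_unit_smul_eq (x : ℂ × V).2
  have hxe' : √(planarFun g (x : ℂ × V).1) • e = (x : ℂ × V).2 := by
    rw [← (mem_handlebodyBoundary.1 hx).2, ← hxe]
  have hcomb : ∀ (s : ℝ) (v : V), (1 - s) • v + s • v = v := fun s v => by
    rw [← add_smul]; simp
  have hq1 : Continuous fun t => (q t : ℂ × V).1 := by fun_prop
  have hq2 : Continuous fun t => (q t : ℂ × V).2 := by fun_prop
  have hqe : Continuous fun t => √(planarFun g (q t : ℂ × V).1) • e :=
    (((continuous_planarFun g).comp hq1).sqrt).smul continuous_const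
  have hqreg : ∀ t, (q t : ℂ × V).1 ∈ planarRegion g := fun t => (mem_handlebody.1 (q t).2).1
  have hq'mem : ∀ t, ((q t : ℂ × V).1, √(planarFun g (q t : ℂ × V).1) • e) ∈
      handlebodyBoundary V g := fun t => sqrt_smul_mem_handlebodyBoundary (hqreg t) he
  let q' : Path x x :=
    { toFun := fun t => ⟨_, handlebodyBoundary_subset (hq'mem t)⟩
      continuous_toFun := (hq1.prodMk hqe).subtype_mk _
      source' := Subtype.ext (by simp only [Path.source]; exact Prod.ext rfl hxe')
      target' := Subtype.ext (by simp only [Path.target]; exact Prod.ext rfl hxe') }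
  refine ⟨q', by rintro _ ⟨t, rfl⟩; exact hq'mem t, Path.Homotopic.Quotient.eq.2
    (Path.Homotopic.symm ?_)⟩
  have hmem : ∀ p : I × I, ((q p.2 : ℂ × V).1, (1 - (p.1 : ℝ)) • (q p.2 : ℂ × V).2 +
      (p.1 : ℝ) • √(planarFun g (q p.2 : ℂ × V).1) • e) ∈ handlebody V g := by
    rintro ⟨s, t⟩
    refine mem_handlebody.2 ⟨hqreg t, ?_⟩
    have h1 := (mem_handlebody.1 (q t).2).2
    have h2 := (mem_handlebodyBoundary.1 (hq'mem t)).2.le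
    have := (convex_closedBall (0 : V) √(planarFun g (q t : ℂ × V).1))
      (mem_closedBall_zero_iff.2 h1) (mem_closedBall_zero_iff.2 h2)
      (by linarith [s.2.2] : 0 ≤ 1 - (s : ℝ)) s.2.1 (by ring)
    exact mem_closedBall_zero_iff.1 this
  have hs : Continuous fun p : I × I => (p.1 : ℝ) := by fun_prop
  refine ⟨⟨⟨⟨fun p => ⟨_, hmem p⟩, ?_⟩, fun t => ?_, fun t => ?_⟩, ?_⟩⟩
  · exact Continuous.subtype_mk ((hq1.comp continuous_snd).prodMk
      (((continuous_const.sub hs).smul (hq2.comp continuous_snd)).add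
        (hs.smul (hqe.comp continuous_snd)))) _
  · exact Subtype.ext (by simp)
  · exact Subtype.ext (by simp [q'])
  · rintro s t (rfl | rfl)
    · exact Subtype.ext (by simp [hxe', hcomb])
    · exact Subtype.ext (by simp [hxe', hcomb])

end Boundary

/-! ### The fundamental group of a trisected manifold -/

theorem loopsIn_mono {M : Type*} [TopologicalSpace M] {Y Y' : Set M} (h : Y ⊆ Y') {x : M}
    (hx : x ∈ Y) : loopsIn Y hx ≤ loopsIn Y' (h hx) := by
  rintro _ ⟨q, hq, rfl⟩
  exact ⟨q, hq.trans h, rfl⟩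

/-- The topological properties of a handlebody `Y` of genus `k` with boundary `S` on which the
computation of the fundamental group depends. -/
structure IsTopHandlebody {M : Type*} [TopologicalSpace M] (k : ℕ) (Y S : Set M) : Prop where
  isClosed : IsClosed Y
  locallyPathConnectedSpace : LocallyPathConnectedSpace Y
  semilocallySimplyConnected : SemilocallySimplyConnected Y
  subset : S ⊆ Y
  nonempty : S.Nonempty
  joinedIn : ∀ x ∈ Y, ∀ y ∈ Y, JoinedIn Y x y
  joinedIn_boundary : ∀ x ∈ S, ∀ y ∈ S, JoinedIn S x y
  loopsIn_le : ∀ (x : M) (hx : x ∈ S), loopsIn Y (subset hx) ≤ loopsIn S hx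
  exists_spine : ∃ (v : M) (ℓ : Fin k → Path v v), IsSpine Y ℓ

section TopHandlebody

variable {M : Type*} [TopologicalSpace M] [T2Space M]

theorem isTopHandlebody_image {V : Type*} [NormedAddCommGroup V] [NormedSpace ℝ V] [ProperSpace V]
    [Nontrivial V] {k : ℕ} {φ : ℂ × V → M} (hφ : ContinuousOn φ (handlebody V k))
    (hinj : InjOn φ (handlebody V k)) :
    IsTopHandlebody k (φ '' handlebody V k) (φ '' handlebodyBoundary V k) := by
  have hcomp : CompactSpace (handlebody V k) := isCompact_iff_compactSpace.1 isCompact_handlebody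
  let f : handlebody V k → M := fun x => φ x
  have hf : IsEmbedding f :=
    (Continuous.isClosedEmbedding hφ.domRestrict hinj.injective).isEmbedding
  have hrange : range f = φ '' handlebody V k := by
    rw [image_eq_range]
  let e : handlebody V k ≃ₜ φ '' handlebody V k := hf.toHomeomorph.trans (Homeomorph.setCongr hrange)
  have he : ∀ x, (e x : M) = φ x := fun x => rfl
  have hcont : ∀ {S x y}, S ⊆ handlebody V k → JoinedIn S x y →
      JoinedIn (φ '' S) (φ x) (φ y) := by
    rintro S x y hS ⟨p, hp⟩
    refine ⟨p.map' (hφ.mono ?_), fun t => ⟨p t, hp t, rfl⟩⟩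
    rintro _ ⟨t, rfl⟩
    exact hS (hp t)
  refine ⟨(isCompact_handlebody.image_of_continuousOn hφ).isClosed,
    e.isQuotientMap.locallyPathConnectedSpace,
        semilocallySimplyConnected_handlebody.of_homeomorph e,
    image_mono handlebodyBoundary_subset, ⟨_, mem_image_of_mem φ (handlebodyBoundary_nonempty V k)⟩,
    ?_, ?_, ?_, ?_⟩
  · rintro _ ⟨x, hx, rfl⟩ _ ⟨y, hy, rfl⟩
    exact hcont subset_rfl (joinedIn_handlebody hx hy)
  · rintro _ ⟨x, hx, rfl⟩ _ ⟨y, hy, rfl⟩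
    exact hcont handlebodyBoundary_subset (joinedIn_handlebodyBoundary hx hy)
  · rintro _ ⟨x, hx, rfl⟩ _ ⟨q, hq, rfl⟩
    let y : handlebody V k := ⟨x, handlebodyBoundary_subset hx⟩
    have hφe : ∀ z : φ '' handlebody V k, φ (e.symm z) = z := fun z => by
      rw [← he, e.apply_symm_apply]
    have hy : ∀ h, y = e.symm ⟨φ x, h⟩ := fun h => by
      rw [Homeomorph.eq_symm_apply]; rfl
    let q₁ : Path y y :=
      ((pathToSubtype q hq).map e.symm.continuous).cast (hy _) (hy _)
    obtain ⟨q₂, hq₂, h⟩ : Path.Homotopic.Quotient.mk q₁ ∈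
        loopsIn (Subtype.val ⁻¹' handlebodyBoundary V k : Set (handlebody V k)) (x := y) hx := by
      rw [loopsIn_handlebodyBoundary y hx]; trivial
    have hh := (Path.Homotopic.Quotient.exact h).map ⟨f, hf.continuous⟩
    refine ⟨q₂.map hf.continuous, ?_, Path.Homotopic.Quotient.eq.2 ?_⟩
    · rintro _ ⟨t, rfl⟩
      exact ⟨q₂ t, hq₂ ⟨t, rfl⟩, rfl⟩
    · have hq₁ : q₁.map hf.continuous = q := Path.ext (funext fun t => hφe _)
      rw [← hq₁]
      exact hh
  · obtain ⟨ℓ, hℓ⟩ := exists_spine_handlebody V k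
    obtain ⟨hv, ℓ', -, hℓ'⟩ := hℓ.exists_subtype
    have := hℓ'.image hf
    rw [image_univ, hrange] at this
    exact ⟨_, _, this⟩

variable [ChartedSpace (EuclideanSpace ℝ (Fin 4)) M]

theorem IsEmbeddedHandlebody₃.isTopHandlebody {g : ℕ} {Y S : Set M}
    (h : IsEmbeddedHandlebody₃ g Y S) : IsTopHandlebody g Y S := by
  obtain ⟨φ, hφ, -, hinj, rfl, rfl⟩ := h
  exact isTopHandlebody_image hφ.continuousOn hinj

theorem IsCorneredHandlebody₄.isTopHandlebody {k : ℕ} {X B C : Set M}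
    (h : IsCorneredHandlebody₄ k X B C) : IsTopHandlebody k X B := by
  obtain ⟨φ, hφ, hinj, rfl, rfl, -⟩ := h
  exact isTopHandlebody_image hφ hinj

variable {g k : ℕ} {X : Fin 3 → Set M}

theorem IsTrisection.exists_mem (h : IsTrisection g k X) : ∃ p, p ∈ ⋂ j, X j :=
  (h.inter 0 1 (by decide)).isTopHandlebody.nonempty

theorem IsTrisection.joinedIn_inter (h : IsTrisection g k X) (i j : Fin 3) {x y : M}
    (hx : x ∈ X i ∩ X j) (hy : y ∈ X i ∩ X j) : JoinedIn (X i ∩ X j) x y := by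
  by_cases hij : i = j
  · subst hij
    rw [inter_self] at *
    exact (h.sector i).isTopHandlebody.joinedIn x hx y hy
  · exact (h.inter i j hij).isTopHandlebody.joinedIn x hx y hy

theorem IsTrisection.pathConnectedSpace (h : IsTrisection g k X) : PathConnectedSpace M := by
  obtain ⟨p, hp⟩ := h.exists_mem
  have key : ∀ x, Joined p x := fun x => by
    obtain ⟨i, hi⟩ := mem_iUnion.1 (h.cover ▸ mem_univ x : x ∈ ⋃ i, X i)
    have hpi := mem_iInter.1 hp i
    exact (h.joinedIn_inter i i ⟨hpi, hpi⟩ ⟨hi, hi⟩).joined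
  exact ⟨⟨p⟩, fun x y => (key x).symm.trans (key y)⟩

/-- The fundamental group of a trisected manifold is generated by the central surface. -/
theorem IsTrisection.loopsIn_central (h : IsTrisection g k X) {p : M} (hp : p ∈ ⋂ j, X j) :
    loopsIn (⋂ j, X j) hp = ⊤ := by
  have := h.pathConnectedSpace
  have hM : SemilocallySimplyConnected M :=
    semilocallySimplyConnected_of_chartedSpace (EuclideanSpace ℝ (Fin 4)) M
  have hpX := mem_iInter.1 hp
  have hinter : ∀ i j (hij : i ≠ j), loopsIn (X i ∩ X j) ⟨hpX i, hpX j⟩ ≤ loopsIn (⋂ j, X j) hp :=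
    fun i j hij => (h.inter i j hij).isTopHandlebody.loopsIn_le p hp
  have hsector : ∀ i, loopsIn (X i) (hpX i) ≤ loopsIn (⋂ j, X j) hp := by
    intro i
    have hi1 : i ≠ i + 1 := by fin_cases i <;> decide
    have hi2 : i ≠ i + 2 := by fin_cases i <;> decide
    have hcentral : (X i ∩ X (i + 1)) ∩ (X i ∩ X (i + 2)) = ⋂ j, X j := by
      ext x
      have hall : ∀ j, j = i ∨ j = i + 1 ∨ j = i + 2 := by fin_cases i <;> decide
      simp only [mem_inter_iff, mem_iInter]
      constructor
      · rintro ⟨⟨h0, h1⟩, -, h2⟩ j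
        rcases hall j with rfl | rfl | rfl <;> assumption
      · exact fun hx => ⟨⟨hx _, hx _⟩, hx _, hx _⟩
    have hbd : p ∈ (X i ∩ X (i + 1)) ∪ (X i ∩ X (i + 2)) := Or.inl ⟨hpX _, hpX _⟩
    refine ((h.sector i).isTopHandlebody.loopsIn_le p hbd).trans ?_
    rintro _ ⟨q, hq, rfl⟩
    let A : Bool → Set M := fun b => if b then X i ∩ X (i + 1) else X i ∩ X (i + 2)
    have hA : ∀ b, IsTopHandlebody g (A b) (⋂ j, X j) := by
      rintro (_ | _)
      · exact (h.inter i (i + 2) hi2).isTopHandlebody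
      · exact (h.inter i (i + 1) hi1).isTopHandlebody
    have hloc : ∀ b, LocallyPathConnectedSpace (A b) := fun b => (hA b).locallyPathConnectedSpace
    have hAA : ∀ b c, b ≠ c → A b ∩ A c = ⋂ j, X j := by
      rintro (_ | _) (_ | _) hbc
      · exact absurd rfl hbc
      · rw [inter_comm]; exact hcentral
      · exact hcentral
      · exact absurd rfl hbc
    refine mem_of_closed_cover hM A (fun b => (hA b).isClosed) (fun b => (hA b).subset hp) ?_ _
      (fun b => (hA b).loopsIn_le p hp) q (hq.trans ?_)
    · intro b c y hy
      by_cases hbc : b = c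
      · subst hbc
        rw [inter_self] at *
        exact (hA b).joinedIn p ((hA b).subset hp) y hy
      · rw [hAA b c hbc] at *
        exact (hA b).joinedIn_boundary p hp y hy
    · exact union_subset (subset_iUnion A true) (subset_iUnion A false)
  have hloc : ∀ i, LocallyPathConnectedSpace (X i) :=
    fun i => (h.sector i).isTopHandlebody.locallyPathConnectedSpace
  rw [eq_top_iff]
  rintro a -
  obtain ⟨q, rfl⟩ := Path.Homotopic.Quotient.mk_surjective a
  exact mem_of_closed_cover hM X (fun i => (h.sector i).isTopHandlebody.isClosed) hpX
    (fun i j y hy => h.joinedIn_inter i j ⟨hpX i, hpX j⟩ hy) _ hsector q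
    (by rw [h.cover]; exact subset_univ _)

theorem IsTrisection.isNielsenClass (h : IsTrisection g k X) (x₀ : M) (i : Fin 3) :
    IsNielsenClass (nielsenClass k (X i) x₀) := by
  have := h.pathConnectedSpace
  obtain ⟨p, hp⟩ := h.exists_mem
  have hX := (h.sector i).isTopHandlebody
  obtain ⟨v, ℓ, hℓ⟩ := hX.exists_spine
  refine isNielsenClass_nielsenClass hX.semilocallySimplyConnected hℓ (mem_iInter.1 hp i) ?_
    (PathConnectedSpace.somePath x₀ v)
  rw [eq_top_iff, ← h.loopsIn_central hp]
  exact loopsIn_mono (iInter_subset X i) hp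

end TopHandlebody

end Trisection

theorem mainTheorem2 {M : Type*} [TopologicalSpace M] [T2Space M] [CompactSpace M]
    [ChartedSpace (EuclideanSpace ℝ (Fin 4)) M] [IsManifold (𝓡 4) ∞ M]
    (g k : ℕ) (X X' : Fin 3 → Set M)
    (hX : Trisection.IsTrisection g k X) (hX' : Trisection.IsTrisection g k X') :
    (∀ (x₀ : M) (i : Fin 3),
      Trisection.IsNielsenClass (Trisection.nielsenClass k (X i) x₀) ∧
      Trisection.IsNielsenClass (Trisection.nielsenClass k (X' i) x₀)) ∧
    (Trisection.AreIsotopic X X' → ∀ (x₀ : M) (i : Fin 3),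
      Trisection.nielsenClass k (X i) x₀ = Trisection.nielsenClass k (X' i) x₀) ∧
    (∀ f : M ≃ₘ⟮𝓡 4, 𝓡 4⟯ M, (∀ i, f '' X i = X' i) → ∀ (x₀ : M) (i : Fin 3),
      Trisection.inducedImage (⟨f, f.continuous⟩ : C(M, M)) x₀
          (Trisection.nielsenClass k (X i) x₀) =
        Trisection.nielsenClass k (X' i) (f x₀)) ∧
    ((∃ f : M ≃ₘ⟮𝓡 4, 𝓡 4⟯ M, ∀ i, f '' X i = X' i) → ∀ x₀ : M,
      ∃ θ : MulAut (FundamentalGroup M x₀), ∀ i : Fin 3,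
        (fun (a : Fin k → FundamentalGroup M x₀) (j : Fin k) => θ (a j)) ''
            Trisection.nielsenClass k (X i) x₀ =
          Trisection.nielsenClass k (X' i) x₀) := by
  have hdiffeo : ∀ f : M ≃ₘ⟮𝓡 4, 𝓡 4⟯ M, (∀ i, f '' X i = X' i) → ∀ (x₀ : M) (i : Fin 3),
      Trisection.inducedImage (⟨f, f.continuous⟩ : C(M, M)) x₀
          (Trisection.nielsenClass k (X i) x₀) = Trisection.nielsenClass k (X' i) (f x₀) := by
    intro f hf x₀ i
    rw [← hf i]
    exact Trisection.map_nielsenClass f.toHomeomorph (X i) x₀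
  refine ⟨fun x₀ i => ⟨hX.isNielsenClass x₀ i, hX'.isNielsenClass x₀ i⟩, ?_, hdiffeo, ?_⟩
  · rintro ⟨F, hF, hF0, hF1⟩ x₀ i
    rw [← hF1 i]
    exact (Trisection.nielsenClass_of_homotopy (F 1).toHomeomorph
      ⟨⟨fun p => F p.1 p.2, hF.continuous⟩, hF0, fun _ => rfl⟩ (X i) x₀).symm
  · rintro ⟨f, hf⟩ x₀
    have := hX.pathConnectedSpace
    let δ : Path x₀ (f x₀) := PathConnectedSpace.somePath _ _
    refine ⟨(MulEquiv.ofBijective _ (Trisection.map_bijective f.toHomeomorph x₀)).trans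
      (Trisection.conjPath δ), fun i => ?_⟩
    rw [← Trisection.nielsenClass_conjPath (X' i) δ, ← hdiffeo f hf x₀ i,
      Trisection.inducedImage, image_image]
    rfl
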